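/- Let all graphs be finite and without loops or multiple edges. A graph is outerplanar if it can be embedded in the plane so that all of its vertices lie on the boundary of one common face. An orientation of a graph $G$ is obtained by replacing each edge by exactly one of the two possible arcs; it is proper if any two adjacent vertices of $G$ have different in-degrees. The proper orientation number $\vec{\chi}(G)$ is the least $k$ such that $G$ has a proper orientation with maximum in-degree at most $k$. Theorem. Every triangle-free, $2$-connected, outerplanar graph $G$ satisfies $\vec{\chi}(G)\le 3$, i.e. it has a proper orientation with maximum in-degree at most $3$. The bound is tight: the graph consisting of a $5$-cycle $C$ and, for each edge $ab$ of $C$, a path of length $4$ from $a$ to $b$ whose internal vertices are new (distinct paths having disjoint sets of internal vertices) is triangle-free, $2$-connected and outerplanar, and its proper orientation number is exactly $3$. -/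

import Mathlib

/-! ### Proper orientations -/

namespace ProperOrientation

/-- The digraph `D` is an orientation of `G`: every arc of `D` comes from an edge of `G`, and every
edge `uv` of `G` is replaced by exactly one of the two arcs `(u, v)` and `(v, u)`. -/
def IsOrientation {V : Type*} (G : SimpleGraph V) (D : Digraph V) : Prop :=
  (∀ u v, D.Adj u v → G.Adj u v) ∧ ∀ u v, G.Adj u v → Xor (D.Adj u v) (D.Adj v u)

/-- The in-degree of `v` in the digraph `D`: the number of `u` such that `(u, v)` is an arc. -/
noncomputable def inDegree {V : Type*} (D : Digraph V) (v : V) : ℕ :=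
  {u | D.Adj u v}.ncard

/-- An orientation of `G` is proper if adjacent vertices of `G` have different in-degrees. -/
def IsProperOrientation {V : Type*} (G : SimpleGraph V) (D : Digraph V) : Prop :=
  IsOrientation G D ∧ ∀ u v, G.Adj u v → inDegree D u ≠ inDegree D v

/-- A proper `k`-orientation is a proper orientation with maximum in-degree at most `k`. -/
def IsProperKOrientation {V : Type*} (G : SimpleGraph V) (k : ℕ) (D : Digraph V) : Prop :=
  IsProperOrientation G D ∧ ∀ v, inDegree D v ≤ k

/-- The proper orientation number of `G`: the least `k` such that `G` has a proper `k`-orientation.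
It takes values in `ℕ∞`, so that it would be `⊤` if there were no such `k`; in particular it is at
most a natural number `k` only if a proper `k`-orientation exists. -/
noncomputable def properOrientationNumber {V : Type*} (G : SimpleGraph V) : ℕ∞ :=
  ⨅ (k : ℕ) (_ : ∃ D : Digraph V, IsProperKOrientation G k D), (k : ℕ∞)

/-! ### Outerplanar and 2-connected graphs -/

/-- An embedding of `G` into the plane: the vertices are distinct points, every edge `uv` is a
simple arc joining the points of `u` and `v` that contains no other vertex, and two different
edges meet only in the points of common end-vertices. -/
structure PlaneEmbedding {V : Type*} (G : SimpleGraph V) where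
  /-- The point representing a vertex. -/
  point : V → ℝ × ℝ
  /-- The set of points of the arc representing an edge. -/
  arc : G.edgeSet → Set (ℝ × ℝ)
  point_injective : Function.Injective point
  isArc : ∀ (u v : V) (h : G.Adj u v), ∃ γ : Path (point u) (point v),
    Function.Injective γ ∧ Set.range γ = arc ⟨s(u, v), h⟩
  mem_of_point_mem_arc : ∀ (e : G.edgeSet) (w : V), point w ∈ arc e → w ∈ (e : Sym2 V)
  arc_inter_arc : ∀ e f : G.edgeSet, e ≠ f → ∀ x ∈ arc e ∩ arc f,
    ∃ w : V, w ∈ (e : Sym2 V) ∧ w ∈ (f : Sym2 V) ∧ point w = x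

/-- The set of all points of the plane that lie on an embedded vertex or edge. -/
def PlaneEmbedding.carrier {V : Type*} {G : SimpleGraph V} (E : PlaneEmbedding G) :
    Set (ℝ × ℝ) :=
  Set.range E.point ∪ ⋃ e, E.arc e

/-- The faces of an embedding: the connected components of the complement of the drawing. -/
def PlaneEmbedding.IsFace {V : Type*} {G : SimpleGraph V} (E : PlaneEmbedding G)
    (F : Set (ℝ × ℝ)) : Prop :=
  ∃ x ∈ E.carrierᶜ, F = connectedComponentIn E.carrierᶜ x

/-- A graph is outerplanar if it has an embedding into the plane such that all the vertices lie on
the boundary of one common face. -/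
def IsOuterplanar {V : Type*} (G : SimpleGraph V) : Prop :=
  ∃ (E : PlaneEmbedding G) (F : Set (ℝ × ℝ)), E.IsFace F ∧ ∀ v, E.point v ∈ frontier F

/-- A graph is 2-connected if it has at least three vertices, is connected, and stays connected
whenever one vertex is deleted. -/
def IsTwoConnected {V : Type*} (G : SimpleGraph V) : Prop :=
  3 ≤ Nat.card V ∧ G.Connected ∧ ∀ v : V, (G.induce {v}ᶜ).Connected

/-! ### A 5-cycle with a path of length 4 attached to each of its edges -/

/-- The 5-cycle on the vertices `(i, 0)`, where in addition the two ends of each cycle edge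
`(i, 0) (i + 1, 0)` are joined by the path `(i, 0), (i, 1), (i, 2), (i, 3), (i + 1, 0)`
of length 4. -/
def fiveCycleWithPaths : SimpleGraph (Fin 5 × Fin 4) :=
  SimpleGraph.fromRel fun u v =>
    (u.2 = 0 ∧ v.2 = 0 ∧ v.1 = u.1 + 1) ∨
    (v.1 = u.1 ∧ (v.2 : ℕ) = (u.2 : ℕ) + 1) ∨
    (u.2 = 3 ∧ v.2 = 0 ∧ v.1 = u.1 + 1)

end ProperOrientation

open ProperOrientation

/-! ### Continuous logarithms and the non-planarity of `K₃,₃` -/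

/-! Upper bound. If an outerplanar graph contained a subdivided `K₂,₃` (a theta graph), a new point
in the common face, joined to an inner vertex of each of its three paths, would give a drawing of
`K₃,₃` (`not_hasTheta`). That `K₃,₃` is not planar follows without the Jordan curve theorem: for
disjoint curves `γ`, `δ` the function `γ s - δ t` has a continuous logarithm, and comparing
logarithm changes over all pairs of disjoint edges gives a parity contradiction
(`not_planar_completeBipartite`). In a 2-connected graph without theta graphs every non-Hamiltonian
cycle can be lengthened by an ear (`exists_longer`), so there is a Hamiltonian cycle; by
triangle-freeness its chords do not cross (`not_crossing`).

Such a graph is built from single edges by series composition at a vertex and by joining the two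
terminals of a piece by an edge. For a piece, record the quadruples consisting of the labels of its
terminals and the in-degrees they receive inside the piece, where every other vertex already has its
label as in-degree. Both operations act on sets of quadruples, and lower bounds for these sets
suffice. Fourteen sets, coded as numbers below `2 ^ 256`, are enough for all pieces that occur, by a
finite check; triangle-freeness ensures that no edge closes a composition of only two blocks. The
whole graph is a block, and each block code has a quadruple whose labels equal the in-degrees
(`block_closes`).

Tightness. With in-degrees at most 2, each cycle edge together with its attached path forces a
minimum number of arcs into the 5-cycle, and these minima add up to more than the in-degrees there
(`not_isProperKOrientation_two`). -/

theorem exists_continuous_log {A : Type*} [TopologicalSpace A] [SimplyConnectedSpace A]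
    [LocallyPathConnectedSpace A] (f : A → ℂ) (hf : Continuous f) (h0 : ∀ x, f x ≠ 0) :
    ∃ L : A → ℂ, Continuous L ∧ ∀ x, Complex.exp (L x) = f x := by
  obtain ⟨x₀⟩ : Nonempty A := inferInstance
  obtain ⟨F, ⟨-, hF⟩, -⟩ := Complex.isCoveringMapOn_exp.existsUnique_continuousMap_lifts
    (f := ⟨f, hf⟩) (a₀ := x₀) (e₀ := Complex.log (f x₀)) (Complex.exp_log (h0 x₀)) (by
      rintro x; exact h0 x)
  exact ⟨F, F.continuous, fun x => congrFun hF x⟩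

open scoped Classical in
/-- The change of a continuous logarithm of `f` between `0` and `1` (junk if there is none). -/
noncomputable def logChange (f : ℝ → ℂ) : ℂ :=
  if h : ∃ L : ℝ → ℂ, Continuous L ∧ ∀ x, Complex.exp (L x) = f x then
    h.choose 1 - h.choose 0 else 0

/-- Two continuous logarithms of one function differ by a continuous, hence constant, integer
multiple of `2πi`, so the chosen one does not matter. -/
theorem logChange_eq {f L : ℝ → ℂ} (hL : Continuous L) (h : ∀ x, Complex.exp (L x) = f x) :
    logChange f = L 1 - L 0 := by
  have hex : ∃ L : ℝ → ℂ, Continuous L ∧ ∀ x, Complex.exp (L x) = f x := ⟨L, hL, h⟩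
  rw [logChange, dif_pos hex]
  obtain ⟨hM, hM'⟩ := hex.choose_spec
  set M := hex.choose
  have hn : ∀ x, ∃ n : ℤ, M x = L x + n * (2 * Real.pi * Complex.I) := fun x =>
    Complex.exp_eq_exp_iff_exists_int.1 ((hM' x).trans (h x).symm)
  choose n hn using hn
  have hc : Continuous fun x => ((n x : ℤ) : ℝ) := by
    have : (fun x => ((n x : ℤ) : ℝ)) = fun x => ((M x - L x) / (2 * Real.pi * Complex.I)).re := by
      funext x
      rw [hn x, add_sub_cancel_left, mul_div_cancel_right₀ _ Complex.two_pi_I_ne_zero]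
      simp
    rw [this]
    fun_prop
  have hcn : Continuous n := Int.isClosedEmbedding_coe_real.isEmbedding.continuous_iff.2 hc
  have : n 1 = n 0 := PreconnectedSpace.constant inferInstance hcn
  rw [hn 1, hn 0, this]; ring

theorem exp_logChange {f : ℝ → ℂ} (hf : Continuous f) (h0 : ∀ x, f x ≠ 0) :
    Complex.exp (logChange f) = f 1 / f 0 := by
  obtain ⟨L, hL, h⟩ := exists_continuous_log f hf h0
  rw [logChange_eq hL h, Complex.exp_sub, h, h]

theorem logChange_neg {f : ℝ → ℂ} (hf : Continuous f) (h0 : ∀ x, f x ≠ 0) :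
    logChange (fun x => - f x) = logChange f := by
  obtain ⟨L, hL, h⟩ := exists_continuous_log f hf h0
  rw [logChange_eq hL h, logChange_eq (L := fun x => L x + Real.pi * Complex.I) (by fun_prop)]
  · ring
  · intro x; rw [Complex.exp_add, h, Complex.exp_pi_mul_I]; ring

/-- Both sides are the change of one logarithm of `γ s - δ t` from `(0, 0)` to `(1, 1)`, taken along
the two halves of the boundary of the unit square. -/
theorem logChange_square {γ δ : ℝ → ℂ} (hγ : Continuous γ) (hδ : Continuous δ)
    (h : ∀ s t, γ s ≠ δ t) :
    logChange (fun s => γ s - δ 0) + logChange (fun t => δ t - γ 1) =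
      logChange (fun t => δ t - γ 0) + logChange (fun s => γ s - δ 1) := by
  obtain ⟨L, hL, hL'⟩ := exists_continuous_log (fun x : ℝ × ℝ => γ x.1 - δ x.2) (by fun_prop)
    (fun x => sub_ne_zero.2 (h _ _))
  have h1 : ∀ r, logChange (fun s => γ s - δ r) = L (1, r) - L (0, r) := fun r =>
    logChange_eq (L := fun s => L (s, r)) (by fun_prop) (fun s => hL' (s, r))
  have h2 : ∀ r, logChange (fun t => δ t - γ r) = L (r, 1) - L (r, 0) := fun r => by
    rw [← logChange_eq (L := fun s => L (r, s)) (by fun_prop) (fun s => hL' (r, s)),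
      ← logChange_neg (by fun_prop) (fun s => sub_ne_zero.2 (h _ _))]
    simp
  rw [h1, h1, h2, h2]; ring

/-- `K₃,₃` is not planar: it cannot be drawn in the plane by curves such that disjoint edges do not
meet. -/
theorem not_planar_completeBipartite (a b : Fin 3 → ℂ) (γ : Fin 3 → Fin 3 → ℝ → ℂ)
    (hc : ∀ i j, Continuous (γ i j)) (h0 : ∀ i j, γ i j 0 = a i) (h1 : ∀ i j, γ i j 1 = b j)
    (hd : ∀ i j k l, i ≠ k → j ≠ l → ∀ s t, γ i j s ≠ γ k l t) : False := by
  have hother : ∀ i : Fin 3, ∃ k, i ≠ k := by decide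
  have ha : ∀ i k, i ≠ k → ∀ j s, γ i j s - a k ≠ 0 := fun i k hik j s => by
    obtain ⟨l, hl⟩ := hother j
    rw [← h0 k l]; exact sub_ne_zero.2 (hd _ _ _ _ hik hl _ _)
  have hb : ∀ j l, j ≠ l → ∀ i s, γ i j s - b l ≠ 0 := fun j l hjl i s => by
    obtain ⟨k, hk⟩ := hother i
    rw [← h1 k l]; exact sub_ne_zero.2 (hd _ _ _ _ hk hjl _ _)
  have hab : ∀ i j, b j - a i ≠ 0 := fun i j => by
    obtain ⟨k, hk⟩ := hother i
    rw [← h1 k j]; exact ha _ _ hk.symm _ _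
  -- chosen logarithms of the differences of the vertices, in convex order
  obtain ⟨c, hcc⟩ : ∃ c : Fin 3 → Fin 3 → ℂ, ∀ j k, Complex.exp (c j k) = b j - a k :=
    ⟨fun j k => Complex.log (b j - a k), fun j k => Complex.exp_log (hab k j)⟩
  -- Reversing a difference changes its sign, which costs `πi`; tying this to the order of the
  -- indices makes the constants in `r1` and `r0` explicit.
  have key : ∀ p : Fin 3 → ℂ, (∀ i k, i ≠ k → p i ≠ p k) → ∃ α : Fin 3 → Fin 3 → ℂ,
      (∀ i k, i ≠ k → Complex.exp (α i k) = p i - p k) ∧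
      ∀ i k, i < k → α k i = α i k + Real.pi * Complex.I := by
    intro p hp
    refine ⟨fun i k => if i < k then Complex.log (p i - p k) else
      Complex.log (p k - p i) + Real.pi * Complex.I, fun i k hik => ?_, fun i k hik => ?_⟩
    · dsimp only
      split_ifs with h
      · exact Complex.exp_log (sub_ne_zero.2 (hp i k hik))
      · rw [Complex.exp_add, Complex.exp_log (sub_ne_zero.2 (hp k i hik.symm)),
          Complex.exp_pi_mul_I]; ring
    · dsimp only
      rw [if_neg hik.le.not_gt, if_pos hik]
  obtain ⟨α, hα, hα'⟩ := key a fun i k hik => by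
    have := ha i k hik 0 0; rw [h0] at this; exact sub_ne_zero.1 this
  obtain ⟨β, hβ, hβ'⟩ := key b fun i k hik => by
    have := hb i k hik 0 1; rw [h1] at this; exact sub_ne_zero.1 this
  have hn : ∀ i j k, ∃ n : ℤ, i ≠ k → logChange (fun s => γ i j s - a k) =
      c j k - α i k + n * (2 * Real.pi * Complex.I) := by
    intro i j k
    by_cases hik : i = k
    · exact ⟨0, fun h => absurd hik h⟩
    · obtain ⟨n, hn⟩ := Complex.exp_eq_exp_iff_exists_int.1
        (show Complex.exp (logChange (fun s => γ i j s - a k)) = Complex.exp (c j k - α i k) by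
          rw [exp_logChange (by have := hc i j; fun_prop) (ha i k hik j), Complex.exp_sub, hcc,
            hα i k hik, h0, h1])
      exact ⟨n, fun _ => hn⟩
  have hm : ∀ i j l, ∃ n : ℤ, j ≠ l → logChange (fun s => γ i j s - b l) =
      β j l - c l i - Real.pi * Complex.I + n * (2 * Real.pi * Complex.I) := by
    intro i j l
    by_cases hjl : j = l
    · exact ⟨0, fun h => absurd hjl h⟩
    · obtain ⟨n, hn⟩ := Complex.exp_eq_exp_iff_exists_int.1
        (show Complex.exp (logChange (fun s => γ i j s - b l)) =
            Complex.exp (β j l - c l i - Real.pi * Complex.I) by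
          rw [exp_logChange (by have := hc i j; fun_prop) (hb j l hjl i), Complex.exp_sub,
            Complex.exp_sub, hcc, hβ j l hjl, h0, h1, Complex.exp_pi_mul_I]
          rw [← neg_sub (b l) (a i)]; field_simp)
      exact ⟨n, fun _ => hn⟩
  choose n hn using hn
  choose m hm using hm
  -- In the square identity all terms `c` cancel, which leaves the reversals of `α` and `β` and an
  -- integer multiple of `2πi`.
  have rel : ∀ i j k l, i ≠ k → j ≠ l → α k i - α i k + (β l j - β j l) =
      (n k l i + m i j l - n i j k - m k l j : ℤ) * (2 * Real.pi * Complex.I) := by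
    intro i j k l hik hjl
    have := logChange_square (hc i j) (hc k l) (hd i j k l hik hjl)
    rw [h0, h1, h0, h1, hn i j k hik, hm k l j hjl.symm, hn k l i hik.symm, hm i j l hjl] at this
    push_cast
    linear_combination this
  have hpi : (Real.pi * Complex.I : ℂ) ≠ 0 := by
    simp [Real.pi_ne_zero]
  have r1 : ∀ i j k l, i < k → j < l → 1 = n k l i + m i j l - n i j k - m k l j := by
    intro i j k l hik hjl
    have := rel i j k l hik.ne hjl.ne
    rw [hα' i k hik, hβ' j l hjl] at this
    have h2 : ((1 : ℤ) : ℂ) = ((n k l i + m i j l - n i j k - m k l j : ℤ) : ℂ) :=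
      mul_right_cancel₀ Complex.two_pi_I_ne_zero (by rw [← this]; push_cast; ring)
    exact_mod_cast h2
  have r0 : ∀ i j k l, i < k → l < j → 0 = n k l i + m i j l - n i j k - m k l j := by
    intro i j k l hik hjl
    have := rel i j k l hik.ne hjl.ne'
    rw [hα' i k hik, hβ' l j hjl] at this
    have h2 : ((0 : ℤ) : ℂ) = ((n k l i + m i j l - n i j k - m k l j : ℤ) : ℂ) :=
      mul_right_cancel₀ Complex.two_pi_I_ne_zero (by rw [← this]; push_cast; ring)
    exact_mod_cast h2
  have h01 : (0 : Fin 3) < 1 := by decide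
  have h02 : (0 : Fin 3) < 2 := by decide
  have h12 : (1 : Fin 3) < 2 := by decide
  have e1 := r1 0 0 1 1 h01 h01
  have e2 := r1 0 0 1 2 h01 h02
  have e3 := r1 0 1 1 2 h01 h12
  have e4 := r1 0 0 2 1 h02 h01
  have e5 := r1 0 0 2 2 h02 h02
  have e6 := r1 0 1 2 2 h02 h12
  have e7 := r1 1 0 2 1 h12 h01
  have e8 := r1 1 0 2 2 h12 h02
  have e9 := r1 1 1 2 2 h12 h12
  have f1 := r0 0 1 1 0 h01 h01
  have f2 := r0 0 2 1 0 h01 h02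
  have f3 := r0 0 2 1 1 h01 h12
  have f4 := r0 0 1 2 0 h02 h01
  have f5 := r0 0 2 2 0 h02 h02
  have f6 := r0 0 2 2 1 h02 h12
  have f7 := r0 1 1 2 0 h12 h01
  have f8 := r0 1 2 2 0 h12 h02
  have f9 := r0 1 2 2 1 h12 h12
  -- Parity: every `n i j k` and every `m i j l` occurs in exactly two of the 18 relations, with
  -- coefficients `±1`, while the left sides add up to 9.
  omega

/-! ### Outerplanar graphs contain no theta graph -/

/-- `u` and `v` are joined by a walk of `G` with all vertices in `S`. -/
def LinkedIn {V : Type*} (G : SimpleGraph V) (S : Set V) (u v : V) : Prop :=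
  ∃ p : G.Walk u v, ∀ x ∈ p.support, x ∈ S

namespace LinkedIn

variable {V : Type*} {G : SimpleGraph V} {S T : Set V} {u v w : V}

theorem refl (h : u ∈ S) : LinkedIn G S u u := ⟨.nil, by simpa using h⟩

theorem symm (h : LinkedIn G S u v) : LinkedIn G S v u := by
  obtain ⟨p, hp⟩ := h
  exact ⟨p.reverse, by simpa using hp⟩

theorem trans (h : LinkedIn G S u v) (h' : LinkedIn G S v w) : LinkedIn G S u w := by
  obtain ⟨p, hp⟩ := h
  obtain ⟨q, hq⟩ := h'
  refine ⟨p.append q, fun x hx => ?_⟩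
  rcases (SimpleGraph.Walk.mem_support_append_iff _ _).1 hx with h | h
  exacts [hp x h, hq x h]

theorem mono (hST : S ⊆ T) (h : LinkedIn G S u v) : LinkedIn G T u v := by
  obtain ⟨p, hp⟩ := h
  exact ⟨p, fun x hx => hST (hp x hx)⟩

theorem of_adj (h : G.Adj u v) (hu : u ∈ S) (hv : v ∈ S) : LinkedIn G S u v :=
  ⟨h.toWalk, by simp [hu, hv]⟩

end LinkedIn

/-- A theta graph in `G` with a vertex in the interior of each of its three paths; equivalently, a
subdivision of `K₂,₃`. -/
def HasTheta {V : Type*} (G : SimpleGraph V) : Prop :=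
  ∃ (u w : V) (v : Fin 3 → V) (S : Fin 3 → Set V), u ≠ w ∧
    (∀ i j, i ≠ j → Disjoint (S i) (S j)) ∧ (∀ i, u ∉ S i) ∧ (∀ i, w ∉ S i) ∧ (∀ i, v i ∈ S i) ∧
    (∀ i, LinkedIn G (insert u (S i)) u (v i)) ∧ ∀ i, LinkedIn G (insert w (S i)) w (v i)

namespace ProperOrientation.PlaneEmbedding

variable {V : Type*} {G : SimpleGraph V} (E : PlaneEmbedding G)

/-- The drawing of the subgraph induced by `S`. -/
def drawing (S : Set V) : Set (ℝ × ℝ) :=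
  E.point '' S ∪ ⋃ (e : G.edgeSet) (_ : ∀ v ∈ (e : Sym2 V), v ∈ S), E.arc e

/-- The points of edges at `v` that are not vertices, except for `v` itself. -/
def openStar (v : V) : Set (ℝ × ℝ) :=
  {x | ∃ e : G.edgeSet, v ∈ (e : Sym2 V) ∧ x ∈ E.arc e ∧ ∀ w, E.point w = x → w = v}

theorem drawing_subset_carrier (S : Set V) : E.drawing S ⊆ E.carrier := by
  rintro x (⟨v, -, rfl⟩ | hx)
  · exact Or.inl ⟨v, rfl⟩
  · simp only [Set.mem_iUnion] at hx
    obtain ⟨e, -, he⟩ := hx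
    exact Or.inr (Set.mem_iUnion.2 ⟨e, he⟩)

theorem disjoint_drawing {S T : Set V} (h : Disjoint S T) :
    Disjoint (E.drawing S) (E.drawing T) := by
  rw [Set.disjoint_left] at h ⊢
  have aux : ∀ {e : G.edgeSet} {x}, x ∈ E.arc e → ∀ {f : G.edgeSet}, x ∈ E.arc f → e ≠ f →
      ∃ w, w ∈ (e : Sym2 V) ∧ w ∈ (f : Sym2 V) := by
    intro e x hx f hx' hef
    obtain ⟨w, h1, h2, -⟩ := E.arc_inter_arc e f hef x ⟨hx, hx'⟩
    exact ⟨w, h1, h2⟩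
  rintro x (⟨v, hv, rfl⟩ | hx) (⟨w, hw, hvw⟩ | hx')
  · exact h hv (E.point_injective hvw ▸ hw)
  · simp only [Set.mem_iUnion] at hx'
    obtain ⟨e, he, hx'⟩ := hx'
    exact h hv (he _ (E.mem_of_point_mem_arc _ _ hx'))
  · simp only [Set.mem_iUnion] at hx
    obtain ⟨e, he, hx⟩ := hx
    rw [← hvw] at hx
    exact h (he _ (E.mem_of_point_mem_arc _ _ hx)) hw
  · simp only [Set.mem_iUnion] at hx hx'
    obtain ⟨e, he, hx⟩ := hx
    obtain ⟨f, hf, hx'⟩ := hx'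
    by_cases hef : e = f
    · subst hef
      obtain ⟨⟨a, b⟩, hab⟩ := e
      exact h (he a (Sym2.mem_mk_left _ _)) (hf a (Sym2.mem_mk_left _ _))
    · obtain ⟨w, h1, h2⟩ := aux hx hx' hef
      exact h (he w h1) (hf w h2)

theorem joinedIn_drawing {S : Set V} {u v : V} (h : LinkedIn G S u v) :
    JoinedIn (E.drawing S) (E.point u) (E.point v) := by
  obtain ⟨p, hp⟩ := h
  induction p with
  | nil => exact JoinedIn.refl (Or.inl ⟨_, hp _ (by simp), rfl⟩)
  | @cons a b c hab p ih =>
    have ha : a ∈ S := hp _ (by simp)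
    have hb : b ∈ S := hp _ (by simp)
    refine JoinedIn.trans ?_ (ih fun x hx => hp x (by simp [hx]))
    obtain ⟨γ, -, hγ⟩ := E.isArc a b hab
    refine ⟨γ, fun t => Or.inr ?_⟩
    simp only [Set.mem_iUnion]
    refine ⟨⟨s(a, b), hab⟩, ?_, hγ ▸ Set.mem_range_self t⟩
    intro w hw
    rcases Sym2.mem_iff.1 hw with rfl | rfl <;> assumption

/-- An edge at `v` is not an edge inside `S`, so it meets the drawing of `S` only in vertices, and
`v` is the only vertex allowed in the star. -/
theorem disjoint_drawing_openStar {S : Set V} {v : V} (hv : v ∉ S) :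
    Disjoint (E.drawing S) (insert (E.point v) (E.openStar v)) := by
  rw [Set.disjoint_left]
  rintro x (⟨w, hw, rfl⟩ | hx) (hxv | ⟨f, hf, hx', hx''⟩)
  · exact hv (E.point_injective hxv ▸ hw)
  · exact hv (hx'' w rfl ▸ hw)
  · simp only [Set.mem_iUnion] at hx
    obtain ⟨e, he, hx⟩ := hx
    exact hv (he _ (E.mem_of_point_mem_arc _ _ (hxv ▸ hx)))
  · simp only [Set.mem_iUnion] at hx
    obtain ⟨e, he, hx⟩ := hx
    have hef : e ≠ f := by rintro rfl; exact hv (he _ hf)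
    obtain ⟨w, h1, -, h3⟩ := E.arc_inter_arc e f hef x ⟨hx, hx'⟩
    exact hv (hx'' w h3 ▸ he w h1)

theorem isCompact_arc (e : G.edgeSet) : IsCompact (E.arc e) := by
  obtain ⟨⟨a, b⟩, hab⟩ := e
  obtain ⟨γ, -, hγ⟩ := E.isArc a b hab
  change IsCompact (E.arc ⟨s(a, b), hab⟩)
  rw [← hγ]
  exact isCompact_range γ.continuous

theorem isClosed_carrier [Finite V] : IsClosed E.carrier :=
  (Set.finite_range _).isClosed.union
    (isClosed_iUnion_of_finite fun e => (E.isCompact_arc e).isClosed)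

theorem joinedIn_openStar {v : V} {z : ℝ × ℝ} (hz : z ∈ E.openStar v) :
    JoinedIn (insert (E.point v) (E.openStar v)) z (E.point v) := by
  obtain ⟨⟨e, he⟩, hve, hze, hzv⟩ := hz
  obtain ⟨w, rfl⟩ := Sym2.mem_iff_exists.1 hve
  obtain ⟨γ, hinj, hγ⟩ := E.isArc v w he
  rw [← hγ] at hze
  obtain ⟨τ, rfl⟩ := hze
  have hvw : v ≠ w := G.ne_of_adj he
  have hτ : τ < 1 := by
    refine lt_of_le_of_ne unitInterval.le_one' fun h => ?_
    rw [h, γ.target] at hzv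
    exact hvw (hzv w rfl).symm
  refine JoinedIn.symm ?_
  have hpc : IsPathConnected (γ '' Set.Iic τ) := by
    refine IsPathConnected.image ?_ γ.continuous
    refine ⟨0, unitInterval.nonneg', fun {y} hy => ?_⟩
    refine ⟨⟨⟨fun s => s * y, by fun_prop⟩, by simp, by simp⟩, fun s => ?_⟩
    exact (unitInterval.mul_le_right).trans hy
  have := hpc.joinedIn (γ 0) ⟨0, unitInterval.nonneg', rfl⟩ (γ τ) ⟨τ, Set.self_mem_Iic, rfl⟩
  rw [γ.source] at this
  refine this.mono ?_
  rintro _ ⟨s, hs, rfl⟩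
  refine Or.inr ⟨⟨s(v, w), he⟩, hve, hγ ▸ Set.mem_range_self s, fun w' hw' => ?_⟩
  have hmem : E.point w' ∈ E.arc ⟨s(v, w), he⟩ := by rw [hw', ← hγ]; exact Set.mem_range_self s
  rcases Sym2.mem_iff.1 (E.mem_of_point_mem_arc _ _ hmem) with rfl | rfl
  · rfl
  · exact absurd (hinj (γ.target.trans hw')) (ne_of_gt (lt_of_le_of_lt hs hτ))

/-- Accessibility of `v` from inside `F` is avoided: from a point of `F` near `v` one goes straight
towards `v`; the first point of the drawing that is met is `v` or lies on an edge at `v`, and that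
edge leads to `v`. -/
theorem joinedIn_face [Finite V] {F : Set (ℝ × ℝ)} (hF : E.IsFace F) {v : V}
    (hv : E.point v ∈ frontier F) {o : ℝ × ℝ} (ho : o ∈ F) :
    JoinedIn (F ∪ insert (E.point v) (E.openStar v)) o (E.point v) := by
  obtain ⟨x₀, hx₀, rfl⟩ := hF
  set F := connectedComponentIn E.carrierᶜ x₀ with hFdef
  have hFo : IsOpen F := E.isClosed_carrier.isOpen_compl.connectedComponentIn
  have hFpc : IsPathConnected F :=
    hFo.isConnected_iff_isPathConnected.1 (isConnected_connectedComponentIn_iff.2 hx₀)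
  -- a ball around `v` that meets only the open star
  have hK : ∃ r > 0, ∀ x ∈ Metric.ball (E.point v) r, x ∈ E.carrier →
      x ∈ insert (E.point v) (E.openStar v) := by
    let K : Set (ℝ × ℝ) := (⋃ (w : V) (_ : w ≠ v), {E.point w}) ∪
      ⋃ (e : G.edgeSet) (_ : v ∉ (e : Sym2 V)), E.arc e
    have hKc : IsClosed K := by
      refine IsClosed.union ?_ ?_
      · exact isClosed_iUnion_of_finite fun w => isClosed_iUnion_of_finite fun _ =>
          isClosed_singleton
      · exact isClosed_iUnion_of_finite fun e => isClosed_iUnion_of_finite fun _ =>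
          (E.isCompact_arc e).isClosed
    have hvK : E.point v ∈ Kᶜ := by
      rintro (h | h)
      · simp only [Set.mem_iUnion] at h
        obtain ⟨w, hw, h⟩ := h
        exact hw (E.point_injective h).symm
      · simp only [Set.mem_iUnion] at h
        obtain ⟨e, he, h⟩ := h
        exact he (E.mem_of_point_mem_arc _ _ h)
    obtain ⟨r, hr, hrK⟩ := Metric.isOpen_iff.1 hKc.isOpen_compl _ hvK
    have hpt : ∀ x ∈ Metric.ball (E.point v) r, ∀ w, E.point w = x → w = v := by
      rintro x hx w rfl
      by_contra hwv
      exact hrK hx (Or.inl (by simp only [Set.mem_iUnion]; exact ⟨w, hwv, rfl⟩))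
    refine ⟨r, hr, fun x hx hxc => ?_⟩
    rcases hxc with ⟨w, rfl⟩ | hxc
    · exact Or.inl (by rw [hpt _ hx w rfl])
    · obtain ⟨e, he⟩ := Set.mem_iUnion.1 hxc
      refine Or.inr ⟨e, ?_, he, hpt x hx⟩
      by_contra hve
      exact hrK hx (Or.inr (by simp only [Set.mem_iUnion]; exact ⟨e, hve, he⟩))
  obtain ⟨r, hr, hball⟩ := hK
  obtain ⟨q, hqF, hqr⟩ := Metric.mem_closure_iff.1 (frontier_subset_closure hv) r hr
  have hq : q ∈ Metric.ball (E.point v) r := by rwa [Metric.mem_ball, dist_comm]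
  -- go from `q` straight to `v` until the drawing is met
  let seg : ℝ → ℝ × ℝ := AffineMap.lineMap q (E.point v)
  have hsegc : Continuous seg := AffineMap.lineMap_continuous
  have hsegb : ∀ t ∈ Set.Icc (0 : ℝ) 1, seg t ∈ Metric.ball (E.point v) r := by
    intro t ht
    refine (convex_ball (E.point v) r).segment_subset hq (Metric.mem_ball_self hr) ?_
    rw [segment_eq_image_lineMap]
    exact ⟨t, ht, rfl⟩
  have hcomp : IsCompact (Set.Icc (0 : ℝ) 1 ∩ seg ⁻¹' E.carrier) :=
    isCompact_Icc.inter_right (E.isClosed_carrier.preimage hsegc)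
  obtain ⟨t₀, ⟨⟨ht₀, ht₀'⟩, ht₀c⟩, hmin⟩ := hcomp.exists_isLeast
    ⟨1, ⟨by simp, Or.inl ⟨v, by simp [seg]⟩⟩⟩
  have hseg0 : seg 0 = q := by simp [seg]
  have hbefore : ∀ t, 0 ≤ t → t < t₀ → seg t ∈ F := by
    intro t ht htt
    have hsub : seg '' Set.Icc 0 t ⊆ F := by
      rw [hFdef, connectedComponentIn_eq (hFdef ▸ hqF)]
      refine IsPreconnected.subset_connectedComponentIn
        (isPreconnected_Icc.image _ hsegc.continuousOn) ⟨0, ⟨le_rfl, ht⟩, hseg0⟩ ?_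
      rintro _ ⟨s, ⟨hs0, hs⟩, rfl⟩ hsc
      have := hmin ⟨⟨hs0, by linarith⟩, hsc⟩
      linarith
    exact hsub ⟨t, ⟨ht, le_rfl⟩, rfl⟩
  have hz := hball _ (hsegb t₀ ⟨ht₀, ht₀'⟩) ht₀c
  have h1 : JoinedIn (F ∪ insert (E.point v) (E.openStar v)) o q :=
    (hFpc.joinedIn o ho q hqF).mono Set.subset_union_left
  have h2 : JoinedIn (F ∪ insert (E.point v) (E.openStar v)) q (seg t₀) := by
    have hpc : IsPathConnected (seg '' Set.Icc 0 t₀) :=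
      ((convex_Icc 0 t₀).isPathConnected ⟨0, le_rfl, ht₀⟩).image hsegc
    refine (hpc.joinedIn q ⟨0, ⟨le_rfl, ht₀⟩, hseg0⟩ _ ⟨t₀, ⟨ht₀, le_rfl⟩, rfl⟩).mono ?_
    rintro _ ⟨s, ⟨hs0, hs⟩, rfl⟩
    rcases hs.eq_or_lt with rfl | hs
    · exact Or.inr hz
    · exact Or.inl (hbefore s hs0 hs)
  refine (h1.trans h2).trans ?_
  rcases hz with hz | hz
  · rw [hz]
    exact JoinedIn.refl (Or.inr (Or.inl rfl))
  · exact (E.joinedIn_openStar hz).mono Set.subset_union_right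

/-- One side of the `K₃,₃` is `u`, `w` and a point `o` of the face, the other is the three `v j`.
Only curves without a common end must be disjoint, so the three curves from `o` may overlap. -/
theorem not_hasTheta [Finite V] {F : Set (ℝ × ℝ)} (hF : E.IsFace F)
    (hv : ∀ v, E.point v ∈ frontier F) : ¬ HasTheta G := by
  rintro ⟨u, w, v, S, huw, hS, hu, hw, hvS, hlu, hlw⟩
  obtain ⟨o, ho⟩ : F.Nonempty := by
    obtain ⟨x, hx, rfl⟩ := hF
    exact ⟨x, mem_connectedComponentIn hx⟩
  have hFc : Disjoint E.carrier F := by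
    obtain ⟨x, hx, rfl⟩ := hF
    exact (Set.subset_compl_iff_disjoint_left).1 (connectedComponentIn_subset _ _)
  let R : Fin 3 → Fin 3 → Set (ℝ × ℝ) := fun i j =>
    ![E.drawing (insert u (S j)), E.drawing (insert w (S j)),
      F ∪ insert (E.point (v j)) (E.openStar (v j))] i
  let a : Fin 3 → ℝ × ℝ := ![E.point u, E.point w, o]
  have hJ : ∀ i j, JoinedIn (R i j) (a i) (E.point (v j)) := by
    intro i j
    fin_cases i
    · exact E.joinedIn_drawing (hlu j)
    · exact E.joinedIn_drawing (hlw j)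
    · exact E.joinedIn_face hF (hv _) ho
  have hvne : ∀ j l, j ≠ l → v l ∉ S j := fun j l hjl h =>
    Set.disjoint_left.1 (hS j l hjl) h (hvS l)
  have hne : ∀ x, (∀ i, x ∉ S i) → ∀ l, v l ≠ x := by
    rintro x hx l rfl
    exact hx l (hvS l)
  have hR01 : ∀ j l, j ≠ l → Disjoint (R 0 j) (R 1 l) := fun j l hjl =>
    E.disjoint_drawing (by
      rw [Set.disjoint_insert_left, Set.disjoint_insert_right]
      refine ⟨?_, hw j, hS j l hjl⟩
      rintro (h | h)
      exacts [huw h, hu l h])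
  have haux : ∀ x, (∀ i, x ∉ S i) → ∀ j l, j ≠ l → Disjoint (E.drawing (insert x (S j)))
      (F ∪ insert (E.point (v l)) (E.openStar (v l))) := by
    intro x hx j l hjl
    refine Set.disjoint_union_right.2 ⟨hFc.mono_left (E.drawing_subset_carrier _),
      E.disjoint_drawing_openStar ?_⟩
    rintro (h | h)
    exacts [hne x hx l h, hvne j l hjl h]
  have hRd : ∀ i j k l, i ≠ k → j ≠ l → Disjoint (R i j) (R k l) := by
    intro i j k l hik hjl
    fin_cases i <;> fin_cases k
    · exact absurd rfl hik
    · exact hR01 j l hjl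
    · exact haux u hu j l hjl
    · exact (hR01 l j hjl.symm).symm
    · exact absurd rfl hik
    · exact haux w hw j l hjl
    · exact (haux u hu l j hjl.symm).symm
    · exact (haux w hw l j hjl.symm).symm
    · exact absurd rfl hik
  let φ : ℝ × ℝ → ℂ := Complex.equivRealProdCLM.symm
  have hφ : Continuous φ := Complex.equivRealProdCLM.symm.continuous
  have hφi : Function.Injective φ := Complex.equivRealProdCLM.symm.injective
  refine not_planar_completeBipartite (φ ∘ a) (fun j => φ (E.point (v j)))
    (fun i j => φ ∘ (hJ i j).somePath.extend) (fun i j => hφ.comp (Path.continuous_extend _))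
    (fun i j => by simp) (fun i j => by simp) ?_
  intro i j k l hik hjl s t hst
  have hmem : ∀ i j s, (hJ i j).somePath.extend s ∈ R i j := by
    intro i j s
    have : (hJ i j).somePath.extend s ∈ Set.range (hJ i j).somePath.extend := ⟨s, rfl⟩
    rw [Path.extend_range] at this
    obtain ⟨r, hr⟩ := this
    rw [← hr]
    exact (hJ i j).somePath_mem r
  exact Set.disjoint_left.1 (hRd i j k l hik hjl) (hmem i j s) (hφi hst ▸ hmem k l t)

end ProperOrientation.PlaneEmbedding

/-! ### Hamiltonian cycles without crossing chords -/

section Hamiltonian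

variable {V : Type*} {G : SimpleGraph V}

theorem HasTheta.of_sets {u w v₀ v₁ v₂ : V} {S₀ S₁ S₂ : Set V} (huw : u ≠ w)
    (h01 : Disjoint S₀ S₁) (h02 : Disjoint S₀ S₂) (h12 : Disjoint S₁ S₂)
    (hu : u ∉ S₀ ∪ S₁ ∪ S₂) (hw : w ∉ S₀ ∪ S₁ ∪ S₂) (h0 : v₀ ∈ S₀) (h1 : v₁ ∈ S₁) (h2 : v₂ ∈ S₂)
    (hu0 : LinkedIn G (insert u S₀) u v₀) (hw0 : LinkedIn G (insert w S₀) w v₀)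
    (hu1 : LinkedIn G (insert u S₁) u v₁) (hw1 : LinkedIn G (insert w S₁) w v₁)
    (hu2 : LinkedIn G (insert u S₂) u v₂) (hw2 : LinkedIn G (insert w S₂) w v₂) : HasTheta G := by
  simp only [Set.mem_union, not_or] at hu hw
  refine ⟨u, w, ![v₀, v₁, v₂], ![S₀, S₁, S₂], huw, ?_, ?_, ?_, ?_, ?_, ?_⟩
  · intro i j hij
    fin_cases i <;> fin_cases j <;> first | exact absurd rfl hij | skip
    exacts [h01, h02, h01.symm, h12, h02.symm, h12.symm]
  · intro i; fin_cases i
    exacts [hu.1.1, hu.1.2, hu.2]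
  · intro i; fin_cases i
    exacts [hw.1.1, hw.1.2, hw.2]
  · intro i; fin_cases i <;> assumption
  · intro i; fin_cases i <;> assumption
  · intro i; fin_cases i <;> assumption

theorem LinkedIn.of_isChain {a : V} {l : List V} (h : List.IsChain G.Adj (a :: l)) {v : V}
    (hv : v ∈ a :: l) : LinkedIn G {x | x ∈ a :: l} a v := by
  induction l generalizing a with
  | nil =>
    obtain rfl : v = a := by simpa using hv
    exact LinkedIn.refl (by simp)
  | cons b l ih =>
    rw [List.isChain_cons_cons] at h
    rcases List.mem_cons.1 hv with rfl | hv
    · exact LinkedIn.refl (by simp)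
    · exact (LinkedIn.of_adj h.1 (by simp) (by simp)).trans
        ((ih h.2 hv).mono fun x hx => List.mem_cons_of_mem _ hx)

theorem LinkedIn.of_path {a b : V} {l : List V} (h : List.IsChain G.Adj (a :: (l ++ [b]))) {v : V}
    (hv : v ∈ l) : LinkedIn G (insert a {x | x ∈ l}) a v := by
  have h' : List.IsChain G.Adj (a :: l) := by
    rw [← List.cons_append] at h; exact (List.isChain_append.1 h).1
  refine (LinkedIn.of_isChain h' (List.mem_cons_of_mem _ hv)).mono fun x hx => ?_
  simpa using hx

theorem isChain_adj_reverse {a b : V} {l : List V} (h : List.IsChain G.Adj (a :: (l ++ [b]))) :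
    List.IsChain G.Adj (b :: (l.reverse ++ [a])) := by
  have := List.isChain_reverse.2 (h.imp fun x y hxy => hxy.symm : List.IsChain
    (fun x y => G.Adj y x) (a :: (l ++ [b])))
  simpa using this

theorem HasTheta.of_paths {a b : V} {s t q : List V} (hab : a ≠ b)
    (hst : s.Disjoint t) (hsq : s.Disjoint q) (htq : t.Disjoint q)
    (ha : a ∉ s ++ t ++ q) (hb : b ∉ s ++ t ++ q) (hs : s ≠ []) (ht : t ≠ []) (hq : q ≠ [])
    (hcs : List.IsChain G.Adj (a :: (s ++ [b]))) (hct : List.IsChain G.Adj (a :: (t ++ [b])))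
    (hcq : List.IsChain G.Adj (a :: (q ++ [b]))) : HasTheta G := by
  obtain ⟨x, hx⟩ := List.exists_mem_of_ne_nil s hs
  obtain ⟨y, hy⟩ := List.exists_mem_of_ne_nil t ht
  obtain ⟨z, hz⟩ := List.exists_mem_of_ne_nil q hq
  have key : ∀ l : List V, ∀ v ∈ l, List.IsChain G.Adj (a :: (l ++ [b])) →
      LinkedIn G (insert b {x | x ∈ l}) b v := by
    intro l v hv hl
    have := LinkedIn.of_path (isChain_adj_reverse hl) (List.mem_reverse.2 hv)
    simpa using this
  refine HasTheta.of_sets (S₀ := {x | x ∈ s}) (S₁ := {x | x ∈ t}) (S₂ := {x | x ∈ q}) hab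
    (Set.disjoint_left.2 fun _ => @hst _) (Set.disjoint_left.2 fun _ => @hsq _)
    (Set.disjoint_left.2 fun _ => @htq _) (by simpa [and_assoc] using ha)
    (by simpa [and_assoc] using hb) hx hy hz
    (.of_path hcs hx) (key s x hx hcs) (.of_path hct hy) (key t y hy hct) (.of_path hcq hz)
    (key q z hz hcq)

/-- The vertices of a cycle of `G`, listed in cyclic order. -/
def IsCycleList (G : SimpleGraph V) (L : List V) : Prop :=
  L.Nodup ∧ (L : Cycle V).Chain G.Adj ∧ 3 ≤ L.length

theorem IsCycleList.exists_rotation {L : List V} (h : IsCycleList G L) {a : V} (ha : a ∈ L) :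
    ∃ l, IsCycleList G (a :: l) ∧ (∀ x, x ∈ a :: l ↔ x ∈ L) ∧ (a :: l).length = L.length := by
  obtain ⟨s, t, rfl⟩ := List.append_of_mem ha
  have hrot : List.IsRotated (s ++ a :: t) (a :: (t ++ s)) := by
    simpa using List.isRotated_append (l := s) (l' := a :: t)
  refine ⟨t ++ s, ⟨hrot.nodup_iff.1 h.1, ?_, ?_⟩, fun x => hrot.mem_iff.symm, hrot.perm.length_eq.symm⟩
  · rw [← Cycle.coe_eq_coe.2 hrot]; exact h.2.1
  · rw [← hrot.perm.length_eq]; exact h.2.2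

/-- The path is cut at its first vertex in `P`. -/
theorem exists_chain_to_set (P : Set V) {x z : V} (p : G.Walk x z) (hp : p.IsPath) (hx : x ∉ P)
    (hz : z ∈ P) : ∃ (q : List V) (b : V), b ∈ P ∧ b ∈ p.support ∧ (x :: q).Nodup ∧
      (∀ y ∈ x :: q, y ∉ P ∧ y ∈ p.support) ∧ List.IsChain G.Adj (x :: (q ++ [b])) := by
  induction p with
  | nil => exact absurd hz hx
  | @cons x n z h p ih =>
    rw [SimpleGraph.Walk.cons_isPath_iff] at hp
    by_cases hn : n ∈ P
    · exact ⟨[], n, hn, by simp, by simp, by simpa using hx, by simpa using h⟩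
    · obtain ⟨q, b, hb, hbs, hnd, hq, hc⟩ := ih hp.1 hn hz
      refine ⟨n :: q, b, hb, by simp [hbs], ?_, ?_, ?_⟩
      · exact List.nodup_cons.2 ⟨fun hxq => hp.2 (hq x hxq).2, hnd⟩
      · intro y hy
        rcases List.mem_cons.1 hy with rfl | hy
        · exact ⟨hx, by simp⟩
        · exact ⟨(hq y hy).1, by simp [(hq y hy).2]⟩
      · rw [List.cons_append, List.isChain_cons_cons]
        exact ⟨h, hc⟩

theorem exists_path_avoiding {a : V} (h : (G.induce {a}ᶜ).Connected) {x z : V} (hx : x ≠ a)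
    (hz : z ≠ a) : ∃ p : G.Walk x z, p.IsPath ∧ a ∉ p.support := by
  classical
  have hx' : x ∈ ({a}ᶜ : Set V) := hx
  have hz' : z ∈ ({a}ᶜ : Set V) := hz
  obtain ⟨p⟩ := h.preconnected ⟨x, hx'⟩ ⟨z, hz'⟩
  have ha : a ∉ (p.map (SimpleGraph.Embedding.induce ({a}ᶜ : Set V)).toHom).support := by
    rw [SimpleGraph.Walk.support_map, List.mem_map]
    rintro ⟨y, -, hy⟩
    exact y.2 hy
  exact ⟨_, SimpleGraph.Walk.bypass_isPath _, fun h =>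
    ha (SimpleGraph.Walk.support_bypass_subset_support _ h)⟩

/-- A vertex `v` has two neighbours `a` and `b`, and a path from `a` to `b` avoiding `v` closes up
to a cycle. -/
theorem exists_isCycleList [Finite V] (h2 : IsTwoConnected G) : ∃ L, IsCycleList G L := by
  obtain ⟨h3, hconn, hdel⟩ := h2
  obtain ⟨v⟩ := hconn.nonempty
  have hex : ∀ S : Set V, S.ncard < 3 → ∃ z, z ∉ S := by
    intro S hS
    by_contra! h
    rw [Set.eq_univ_of_forall h, Set.ncard_univ] at hS
    omega
  have hnb : ∀ {u z : V} (p : G.Walk u z), u ≠ z → ∃ b ∈ p.support, G.Adj u b := by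
    intro u z p huz
    cases p with
    | nil => exact absurd rfl huz
    | cons h p => exact ⟨_, by simp, h⟩
  obtain ⟨y, hy⟩ := hex {v} (by simp)
  obtain ⟨p⟩ := hconn.preconnected v y
  obtain ⟨a, -, hva⟩ := hnb p (fun h => hy h.symm)
  obtain ⟨z, hz⟩ := hex {v, a} (lt_of_le_of_lt (Set.ncard_insert_le _ _) (by simp))
  simp only [Set.mem_insert_iff, Set.mem_singleton_iff, not_or] at hz
  obtain ⟨p, -, hp⟩ := exists_path_avoiding (hdel a) hva.ne hz.2
  obtain ⟨b, hb, hvb⟩ := hnb p (fun h => hz.1 h.symm)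
  have hab : a ≠ b := by rintro rfl; exact hp hb
  obtain ⟨p, hp, hvp⟩ := exists_path_avoiding (hdel v) hva.ne' hvb.ne'
  obtain ⟨q, b', hb', -, hnd, hq, hc⟩ := exists_chain_to_set {b} p hp hab rfl
  obtain rfl : b' = b := hb'
  refine ⟨v :: a :: (q ++ [b']), ?_, ?_, by simp⟩
  · rw [List.nodup_cons, ← List.cons_append]
    constructor
    · intro hv
      rcases List.mem_append.1 hv with hv | hv
      · exact hvp (hq v hv).2
      · exact hvb.ne (by simpa using hv)
    · refine List.nodup_append.2 ⟨hnd, by simp, ?_⟩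
      rintro x hx y hy rfl
      exact (hq x hx).1 (by simpa using hy)
  · rw [Cycle.chain_coe_cons, List.cons_append, List.isChain_cons_cons]
    refine ⟨hva, ?_⟩
    rw [← List.cons_append] at hc ⊢
    rw [← List.cons_append]
    rw [List.append_assoc, List.singleton_append, List.isChain_split]
    exact ⟨hc, by simpa using hvb.symm⟩

/-- An edge leaving the cycle at `a` extends, within the graph without `a`, to an ear that returns
at some `b ≠ a`. -/
theorem IsCycleList.exists_longer (h2 : IsTwoConnected G) (hth : ¬ HasTheta G) {L : List V}
    (hL : IsCycleList G L) {z : V} (hz : z ∉ L) :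
    ∃ L', IsCycleList G L' ∧ L.length < L'.length := by
  obtain ⟨h3, hconn, hdel⟩ := h2
  obtain ⟨a, ha, x, hx, hax⟩ : ∃ a ∈ L, ∃ x ∉ L, G.Adj a x := by
    obtain ⟨y, hy⟩ := List.exists_mem_of_length_pos (l := L) (by have := hL.2.2; omega)
    obtain ⟨p⟩ := hconn.preconnected y z
    obtain ⟨d, -, h1, h2⟩ := p.exists_boundary_dart {v | v ∈ L} hy hz
    exact ⟨d.fst, h1, d.snd, h2, d.adj⟩
  obtain ⟨l, hl, hmem, hlen⟩ := hL.exists_rotation ha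
  rw [← hlen]
  rw [← hmem] at hx
  clear hmem hlen ha hz hL
  obtain ⟨hnd, hch, hlen⟩ := hl
  rw [Cycle.chain_coe_cons] at hch
  obtain ⟨y, hy⟩ := List.exists_mem_of_length_pos (l := l) (by simp at hlen; omega)
  have hya : y ≠ a := by rintro rfl; exact (List.nodup_cons.1 hnd).1 hy
  obtain ⟨p, hp, hap⟩ := exists_path_avoiding (hdel a) hax.ne' hya
  obtain ⟨q, b, hb, hbp, hqnd, hq, hqc⟩ := exists_chain_to_set {v | v ∈ a :: l} p hp hx
    (List.mem_cons_of_mem _ hy)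
  have hba : b ≠ a := by rintro rfl; exact hap hbp
  have hbl : b ∈ l := (List.mem_cons.1 hb).resolve_left hba
  have hqc : List.IsChain G.Adj (a :: ((x :: q) ++ [b])) := by
    rw [List.cons_append, List.isChain_cons_cons]; exact ⟨hax, hqc⟩
  replace hq : ∀ y ∈ x :: q, y ∉ a :: l := fun y hy => (hq y hy).1
  have hq0 : x :: q ≠ [] := List.cons_ne_nil _ _
  generalize x :: q = Q at hqc hq hqnd hq0
  have hQ : 0 < Q.length := List.length_pos_iff.2 hq0
  obtain ⟨s, t, rfl⟩ := List.append_of_mem hbl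
  have hsplit : List.IsChain G.Adj (a :: (s ++ [b])) ∧ List.IsChain G.Adj (b :: (t ++ [a])) := by
    rw [List.append_assoc, List.cons_append, ← List.cons_append, List.isChain_split] at hch
    exact hch
  -- Here `b` follows `a` on the cycle, and the ear replaces the edge `ab`.
  rcases eq_or_ne s [] with rfl | hs
  · refine ⟨a :: (Q ++ b :: t), ⟨?_, ?_, ?_⟩, ?_⟩
    · have : (Q ++ a :: b :: t).Nodup := by
        refine List.nodup_append.2 ⟨hqnd, hnd, ?_⟩
        rintro u hu v hv rfl
        exact hq u hu hv
      exact (List.perm_middle.nodup_iff).1 this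
    · rw [Cycle.chain_coe_cons, List.append_assoc, List.cons_append, ← List.cons_append,
        List.isChain_split]
      exact ⟨hqc, hsplit.2⟩
    · simp at hlen ⊢; omega
    · simp; omega
  -- Here `b` precedes `a`, and the reversed ear replaces the edge `ba`.
  rcases eq_or_ne t [] with rfl | ht
  · refine ⟨a :: ((s ++ [b]) ++ Q.reverse), ⟨?_, ?_, ?_⟩, ?_⟩
    · rw [← List.cons_append]
      refine List.nodup_append.2 ⟨hnd, List.nodup_reverse.2 hqnd, ?_⟩
      rintro u hu v hv rfl
      exact hq u (List.mem_reverse.1 hv) hu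
    · rw [Cycle.chain_coe_cons, List.append_assoc, List.append_assoc, List.singleton_append,
        ← List.cons_append, List.isChain_split]
      exact ⟨hsplit.1, isChain_adj_reverse hqc⟩
    · simp; omega
    · simp; omega
  -- Both arcs between `a` and `b` have inner vertices, so together with the ear they form a theta
  -- graph.
  · refine absurd ?_ hth
    have hnd' : a ∉ s ∧ a ∉ t ∧ b ∉ s ∧ b ∉ t ∧ s.Disjoint t := by
      simp only [List.nodup_cons, List.nodup_append, List.mem_append, List.mem_cons, not_or] at hnd
      refine ⟨hnd.1.1, hnd.1.2.2, fun h => hnd.2.2.2 b h b (by simp) rfl, hnd.2.2.1.1,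
        fun u hu hu' => hnd.2.2.2 u hu u (by simp [hu']) rfl⟩
    obtain ⟨h1, h2, h3, h4, h5⟩ := hnd'
    refine HasTheta.of_paths (s := s) (t := t.reverse) (q := Q) hba.symm ?_ ?_ ?_ ?_ ?_ hs
      (by simpa using ht) hq0 hsplit.1 (isChain_adj_reverse hsplit.2) hqc
    · intro u hu hu'; exact h5 hu (by simpa using hu')
    · intro u hu hu'; exact hq u hu' (by simp [hu])
    · intro u hu hu'; exact hq u hu' (by simp at hu; simp [hu])
    · have := fun h => hq a h
      simp at this ⊢; exact ⟨h1, h2, this⟩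
    · have := fun h => hq b h
      simp at this ⊢; exact ⟨h3, h4, this⟩

theorem exists_hamiltonian [Finite V] (h2 : IsTwoConnected G) (hth : ¬ HasTheta G) :
    ∃ L, IsCycleList G L ∧ ∀ v, v ∈ L := by
  by_contra! hno
  have hlong : ∀ k : ℕ, ∃ L, IsCycleList G L ∧ k ≤ L.length := by
    intro k
    induction k with
    | zero => obtain ⟨L, hL⟩ := exists_isCycleList h2; exact ⟨L, hL, Nat.zero_le _⟩
    | succ k ih =>
      obtain ⟨L, hL, hk⟩ := ih
      obtain ⟨z, hz⟩ := hno L hL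
      obtain ⟨L', hL', hlt⟩ := hL.exists_longer h2 hth hz
      exact ⟨L', hL', by omega⟩
  obtain ⟨L, hL, hk⟩ := hlong (Nat.card V + 1)
  have := Fintype.ofFinite V
  have := hL.1.length_le_card
  rw [Nat.card_eq_fintype_card] at hk
  omega

/-- An enumeration of the vertices of `G` along a Hamiltonian cycle. -/
structure IsHamiltonianOrder (G : SimpleGraph V) (n : ℕ) (c : ℕ → V) : Prop where
  three_le : 3 ≤ n
  inj : ∀ i j, i < n → j < n → c i = c j → i = j
  surj : ∀ v, ∃ i < n, c i = v
  adj_succ : ∀ i, i + 1 < n → G.Adj (c i) (c (i + 1))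
  adj_last : G.Adj (c (n - 1)) (c 0)

theorem exists_isHamiltonianOrder [Finite V] (h2 : IsTwoConnected G) (hth : ¬ HasTheta G) :
    ∃ n c, IsHamiltonianOrder G n c := by
  obtain ⟨L, ⟨hnd, hch, hlen⟩, hall⟩ := exists_hamiltonian h2 hth
  cases L with
  | nil => simp at hlen
  | cons a l =>
    rw [Cycle.chain_coe_cons] at hch
    have hch' := List.isChain_iff_getElem.1 hch
    have hget : ∀ i (h : i < (a :: l).length), (a :: l).getD i a = (a :: l)[i] := fun i h =>
      (List.getD_eq_getElem _ _ h)
    refine ⟨(a :: l).length, fun i => (a :: l).getD i a, hlen, ?_, ?_, ?_, ?_⟩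
    · intro i j hi hj hij
      rw [hget i hi, hget j hj] at hij
      exact (hnd.getElem_inj_iff).1 hij
    · intro v
      obtain ⟨i, hi, h⟩ := List.mem_iff_getElem.1 (hall v)
      exact ⟨i, hi, by rw [hget i hi, h]⟩
    · intro i hi
      have := hch' i (by simp at hi ⊢; omega)
      rw [hget i (by omega), hget (i + 1) hi]
      simp only [← List.cons_append] at this
      rwa [List.getElem_append_left (by omega), List.getElem_append_left (by omega)] at this
    · have := hch' l.length (by simp)
      rw [hget _ (by simp), hget 0 (by simp)]
      simp only [← List.cons_append] at this
      rw [List.getElem_append_left (by simp), List.getElem_append_right (by simp)] at this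
      simpa using this

/-! ### Chords of a Hamiltonian cycle. -/

namespace IsHamiltonianOrder

variable {n : ℕ} {c : ℕ → V}

theorem linkedIn_Icc (h : IsHamiltonianOrder G n c) {i j : ℕ} (hij : i ≤ j) (hj : j < n) :
    LinkedIn G (c '' Set.Icc i j) (c i) (c j) := by
  induction j, hij using Nat.le_induction with
  | base => exact LinkedIn.refl ⟨i, by simp, rfl⟩
  | succ j hij ih =>
    refine ((ih (by omega)).mono (Set.image_mono (Set.Icc_subset_Icc_right (by omega)))).trans
      (LinkedIn.of_adj (h.adj_succ j hj) ⟨j, ⟨hij, by omega⟩, rfl⟩ ⟨j + 1, ⟨by omega, le_rfl⟩, rfl⟩)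

theorem disjoint_image (h : IsHamiltonianOrder G n c) {A B : Set ℕ} (hA : ∀ i ∈ A, i < n)
    (hB : ∀ i ∈ B, i < n) (hAB : ∀ i ∈ A, i ∉ B) : Disjoint (c '' A) (c '' B) := by
  rw [Set.disjoint_left]
  rintro _ ⟨i, hi, rfl⟩ ⟨j, hj, hij⟩
  obtain rfl := h.inj j i (hB j hj) (hA i hi) hij
  exact hAB _ hi hj

theorem notMem_image (h : IsHamiltonianOrder G n c) {A : Set ℕ} (hA : ∀ i ∈ A, i < n) {i : ℕ}
    (hi : i < n) (hiA : i ∉ A) : c i ∉ c '' A := by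
  rintro ⟨j, hj, hij⟩
  exact hiA (h.inj j i (hA j hj) hi hij ▸ hj)

theorem insert_subset {A B : Set ℕ} {i : ℕ} (hAB : B ⊆ insert i A) :
    c '' B ⊆ insert (c i) (c '' A) := by
  rw [← Set.image_insert_eq]; exact Set.image_mono hAB

/-- Edges do not cross in a triangle-free graph without theta graphs. -/
theorem not_crossing (h : IsHamiltonianOrder G n c) (hth : ¬ HasTheta G) (htf : G.CliqueFree 3)
    {i j k l : ℕ} (hij : i < j) (hjk : j < k) (hkl : k < l) (hl : l < n)
    (hik : G.Adj (c i) (c k)) (hjl : G.Adj (c j) (c l)) : False := by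
  have hself : ∀ {S : Set V} {v : V}, v ∈ insert v S := fun {S v} => Set.mem_insert v S
  by_cases h1 : i + 1 = j
  · by_cases h2 : j + 1 = k
    · classical
      -- Three consecutive vertices and the chord `ik` form a triangle. Excluding theta graphs alone
      -- would not do here: in `K₄` the chords of a Hamiltonian cycle cross.
      refine htf {c i, c j, c k} (SimpleGraph.is3Clique_triple_iff.2 ⟨?_, hik, ?_⟩)
      · rw [← h1]; exact h.adj_succ i (by omega)
      · rw [← h2]; exact h.adj_succ j (by omega)
    -- Three paths from `c j` to `c k`: along the cycle, through `c i` and the chord `ik`, and by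
    -- the chord `jl` and then back along the cycle.
    · refine hth (HasTheta.of_sets (u := c j) (w := c k) (v₀ := c (j + 1)) (v₁ := c i) (v₂ := c l)
        (S₀ := c '' Set.Ioo j k) (S₁ := c '' Set.Ico i j) (S₂ := c '' Set.Ioc k l)
        (fun e => ?_) (h.disjoint_image ?_ ?_ ?_) (h.disjoint_image ?_ ?_ ?_)
        (h.disjoint_image ?_ ?_ ?_) ?_ ?_ ?_ ?_ ?_ ?_ ?_ ?_ ?_ ?_ ?_)
      · have := h.inj _ _ (by omega) (by omega) e; omega
      iterate 9 (simp only [Set.mem_Ioo, Set.mem_Ico, Set.mem_Ioc]; intros; omega)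
      · rw [← Set.image_union, ← Set.image_union]
        refine h.notMem_image ?_ (by omega) ?_
        · simp only [Set.mem_union, Set.mem_Ioo, Set.mem_Ico, Set.mem_Ioc]; intros; omega
        · simp only [Set.mem_union, Set.mem_Ioo, Set.mem_Ico, Set.mem_Ioc]; omega
      · rw [← Set.image_union, ← Set.image_union]
        refine h.notMem_image ?_ (by omega) ?_
        · simp only [Set.mem_union, Set.mem_Ioo, Set.mem_Ico, Set.mem_Ioc]; intros; omega
        · simp only [Set.mem_union, Set.mem_Ioo, Set.mem_Ico, Set.mem_Ioc]; omega
      · exact ⟨j + 1, ⟨by omega, by omega⟩, rfl⟩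
      · exact ⟨i, ⟨by omega, by omega⟩, rfl⟩
      · exact ⟨l, ⟨by omega, by omega⟩, rfl⟩
      · refine LinkedIn.of_adj (h.adj_succ j (by omega)) hself (Or.inr ?_)
        exact ⟨j + 1, ⟨by omega, by omega⟩, rfl⟩
      · refine (h.linkedIn_Icc (i := j + 1) (j := k) (by omega) (by omega)).symm.mono
          (insert_subset fun m => ?_)
        simp only [Set.mem_Icc, Set.mem_insert_iff, Set.mem_Ioo]; omega
      · refine (h.linkedIn_Icc (i := i) (j := j) (by omega) (by omega)).symm.mono
          (insert_subset fun m => ?_)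
        simp only [Set.mem_Icc, Set.mem_insert_iff, Set.mem_Ico]; omega
      · exact LinkedIn.of_adj hik.symm hself (Or.inr ⟨i, ⟨by omega, by omega⟩, rfl⟩)
      · exact LinkedIn.of_adj hjl hself (Or.inr ⟨l, ⟨by omega, by omega⟩, rfl⟩)
      · refine (h.linkedIn_Icc (i := k) (j := l) (by omega) (by omega)).mono
          (insert_subset fun m => ?_)
        simp only [Set.mem_Icc, Set.mem_insert_iff, Set.mem_Ioc]; omega
  -- Three paths from `c i` to `c j`: along the cycle, by the chord `ik` and back to `c j`, and
  -- backwards through `c 0` and `c (n - 1)` to `c l`, then by the chord `jl`. The last one runs in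
  -- `A`.
  · let A : Set ℕ := {m | m < n ∧ (l ≤ m ∨ m < i)}
    have hA : ∀ m, m ∈ A ↔ m < n ∧ (l ≤ m ∨ m < i) := fun m => Iff.rfl
    refine hth (HasTheta.of_sets (u := c i) (w := c j) (v₀ := c (i + 1)) (v₁ := c k) (v₂ := c l)
        (S₀ := c '' Set.Ioo i j) (S₁ := c '' Set.Ioc j k) (S₂ := c '' A)
        (fun e => ?_) (h.disjoint_image ?_ ?_ ?_) (h.disjoint_image ?_ ?_ ?_)
        (h.disjoint_image ?_ ?_ ?_) ?_ ?_ ?_ ?_ ?_ ?_ ?_ ?_ ?_ ?_ ?_)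
    · have := h.inj _ _ (by omega) (by omega) e; omega
    iterate 9 (simp only [Set.mem_Ioo, hA, Set.mem_Ioc]; intros; omega)
    · rw [← Set.image_union, ← Set.image_union]
      refine h.notMem_image ?_ (by omega) ?_
      · simp only [Set.mem_union, Set.mem_Ioo, hA, Set.mem_Ioc]; intros; omega
      · simp only [Set.mem_union, Set.mem_Ioo, hA, Set.mem_Ioc]; omega
    · rw [← Set.image_union, ← Set.image_union]
      refine h.notMem_image ?_ (by omega) ?_
      · simp only [Set.mem_union, Set.mem_Ioo, hA, Set.mem_Ioc]; intros; omega
      · simp only [Set.mem_union, Set.mem_Ioo, hA, Set.mem_Ioc]; omega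
    · exact ⟨i + 1, ⟨by omega, by omega⟩, rfl⟩
    · exact ⟨k, ⟨by omega, by omega⟩, rfl⟩
    · exact ⟨l, ⟨by omega, by omega⟩, rfl⟩
    · refine LinkedIn.of_adj (h.adj_succ i (by omega)) hself (Or.inr ?_)
      exact ⟨i + 1, ⟨by omega, by omega⟩, rfl⟩
    · refine (h.linkedIn_Icc (i := i + 1) (j := j) (by omega) (by omega)).symm.mono
        (insert_subset fun m => ?_)
      simp only [Set.mem_Icc, Set.mem_insert_iff, Set.mem_Ioo]; omega
    · exact LinkedIn.of_adj hik hself (Or.inr ⟨k, ⟨by omega, by omega⟩, rfl⟩)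
    · refine (h.linkedIn_Icc (i := j) (j := k) (by omega) (by omega)).mono
        (insert_subset fun m => ?_)
      simp only [Set.mem_Icc, Set.mem_insert_iff, Set.mem_Ioc]; omega
    · refine LinkedIn.trans (v := c 0) ?_ (LinkedIn.trans (v := c (n - 1)) ?_ ?_)
      · refine (h.linkedIn_Icc (i := 0) (j := i) (by omega) (by omega)).symm.mono
          (insert_subset fun m => ?_)
        simp only [Set.mem_Icc, Set.mem_insert_iff, hA]; omega
      · refine LinkedIn.of_adj h.adj_last.symm (insert_subset (B := {0}) ?_ ⟨0, rfl, rfl⟩)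
          (Or.inr ⟨n - 1, (hA _).2 (by omega), rfl⟩)
        simp only [Set.singleton_subset_iff, Set.mem_insert_iff, hA]; omega
      · refine (h.linkedIn_Icc (i := l) (j := n - 1) (by omega) (by omega)).symm.mono
          (insert_subset fun m => ?_)
        simp only [Set.mem_Icc, Set.mem_insert_iff, hA]; omega
    · exact LinkedIn.of_adj hjl hself (Or.inr ⟨l, (hA _).2 (by omega), rfl⟩)

end IsHamiltonianOrder

end Hamiltonian

/-! ### Orientations with prescribed in-degrees at two terminals -/

section Terminals

variable {V : Type*}

theorem isOrientation_sup {H₁ H₂ : SimpleGraph V} {D₁ D₂ : Digraph V} (h₁ : IsOrientation H₁ D₁)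
    (h₂ : IsOrientation H₂ D₂) (hd : ∀ u v, H₁.Adj u v → ¬ H₂.Adj u v) :
    IsOrientation (H₁ ⊔ H₂) (D₁ ⊔ D₂) := by
  refine ⟨fun u v h => h.imp (h₁.1 u v) (h₂.1 u v), fun u v h => ?_⟩
  rcases h with h | h
  · have h' := hd _ _ h
    have h'' := hd _ _ h.symm
    have e1 : ¬ D₂.Adj u v := fun e => h' (h₂.1 _ _ e)
    have e2 : ¬ D₂.Adj v u := fun e => h'' (h₂.1 _ _ e)
    simpa [Digraph.sup_adj, e1, e2] using h₁.2 u v h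
  · have e1 : ¬ D₁.Adj u v := fun e => hd _ _ (h₁.1 _ _ e) h
    have e2 : ¬ D₁.Adj v u := fun e => hd _ _ (h₁.1 _ _ e) h.symm
    simpa [Digraph.sup_adj, e1, e2] using h₂.2 u v h

theorem inDegree_sup [Finite V] {D₁ D₂ : Digraph V} (hd : ∀ u v, D₁.Adj u v → ¬ D₂.Adj u v)
    (v : V) : inDegree (D₁ ⊔ D₂) v = inDegree D₁ v + inDegree D₂ v := by
  rw [inDegree, inDegree, inDegree, ← Set.ncard_union_eq]
  · rfl
  · exact Set.disjoint_left.2 fun u h h' => hd u v h h'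

theorem inDegree_eq_zero {H : SimpleGraph V} {D : Digraph V} (h : IsOrientation H D) {v : V}
    (hv : v ∉ H.support) : inDegree D v = 0 := by
  have : {u | D.Adj u v} = ∅ := by
    ext u
    simp only [Set.mem_ofPred_eq, Set.mem_empty_iff_false, iff_false]
    exact fun hu => hv ⟨u, (h.1 u v hu).symm⟩
  rw [inDegree, this, Set.ncard_empty]

/-- `H` has an orientation and a proper labelling by `0, 1, 2, 3` such that the labels are the
in-degrees, except at `a` and `b`, which have labels `fa` and `fb` but in-degrees `ca` and `cb`. -/
def Realizes (H : SimpleGraph V) (a b : V) (fa fb ca cb : ℕ) : Prop :=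
  ∃ (D : Digraph V) (f : V → ℕ), IsOrientation H D ∧ (∀ x y, H.Adj x y → f x ≠ f y) ∧
    (∀ x ∈ H.support, x ≠ a → x ≠ b → inDegree D x = f x) ∧ (∀ x, f x ≤ 3) ∧
    f a = fa ∧ f b = fb ∧ inDegree D a = ca ∧ inDegree D b = cb

/-- Only `m` receives arcs from both parts, so `c + d = fm` is all that is needed there. -/
theorem Realizes.series [Finite V] {H₁ H₂ : SimpleGraph V} {a m b : V} {fa fm fb ca c d cb : ℕ}
    (h₁ : Realizes H₁ a m fa fm ca c) (h₂ : Realizes H₂ m b fm fb d cb) (hcd : c + d = fm)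
    (hm : ∀ x ∈ H₁.support, x ∈ H₂.support → x = m) (ha : a ∉ H₂.support) (hb : b ∉ H₁.support)
    (hab : a ≠ b) (ham : a ≠ m) : Realizes (H₁ ⊔ H₂) a b fa fb ca cb := by
  classical
  obtain ⟨D₁, f₁, ho₁, hp₁, hi₁, hl₁, rfl, hfm₁, rfl, rfl⟩ := h₁
  obtain ⟨D₂, f₂, ho₂, hp₂, hi₂, hl₂, hfm₂, rfl, rfl, rfl⟩ := h₂
  have hdisj : ∀ u v, H₁.Adj u v → ¬ H₂.Adj u v := fun u v h h' => h.ne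
    ((hm u ⟨v, h⟩ ⟨v, h'⟩).trans (hm v ⟨u, h.symm⟩ ⟨u, h'.symm⟩).symm)
  have hdeg := inDegree_sup (D₁ := D₁) (D₂ := D₂)
    fun u v h h' => hdisj u v (ho₁.1 _ _ h) (ho₂.1 _ _ h')
  -- The vertex `a` is listed separately because it may be isolated in `H₁`.
  let f : V → ℕ := fun x => if x ∈ H₁.support ∨ x = a then f₁ x else f₂ x
  have hf₁ : ∀ x ∈ H₁.support, f x = f₁ x := fun x hx => if_pos (Or.inl hx)
  have hf₂ : ∀ x ∈ H₂.support, f x = f₂ x := by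
    intro x hx
    by_cases h : x ∈ H₁.support
    · rw [hf₁ x h, hm x h hx, hfm₁, hfm₂]
    · refine if_neg ?_
      rintro (h' | rfl)
      exacts [h h', ha hx]
  refine ⟨D₁ ⊔ D₂, f, isOrientation_sup ho₁ ho₂ hdisj, ?_, ?_, ?_, if_pos (Or.inr rfl), ?_, ?_, ?_⟩
  · rintro x y (h | h)
    · rw [hf₁ x ⟨y, h⟩, hf₁ y ⟨x, h.symm⟩]; exact hp₁ x y h
    · rw [hf₂ x ⟨y, h⟩, hf₂ y ⟨x, h.symm⟩]; exact hp₂ x y h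
  · intro x hx hxa hxb
    rw [hdeg]
    by_cases hxm : x = m
    · subst hxm
      rw [hcd]
      rcases hx with ⟨y, h | h⟩
      · rw [hf₁ x ⟨y, h⟩, hfm₁]
      · rw [hf₂ x ⟨y, h⟩, hfm₂]
    · by_cases h1 : x ∈ H₁.support
      · rw [inDegree_eq_zero ho₂ fun h2 => hxm (hm x h1 h2), hi₁ x h1 hxa hxm, hf₁ x h1, add_zero]
      · have h2 : x ∈ H₂.support := by
          obtain ⟨y, h | h⟩ := hx
          exacts [absurd ⟨y, h⟩ h1, ⟨y, h⟩]
        rw [inDegree_eq_zero ho₁ h1, hi₂ x h2 hxm hxb, hf₂ x h2, zero_add]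
  · intro x
    by_cases h : x ∈ H₁.support ∨ x = a
    · exact (if_pos h).trans_le (hl₁ x)
    · exact (if_neg h).trans_le (hl₂ x)
  · refine if_neg ?_
    rintro (h | h)
    exacts [hb h, hab h.symm]
  · rw [hdeg, inDegree_eq_zero ho₂ ha, add_zero]
  · rw [hdeg, inDegree_eq_zero ho₁ hb, zero_add]

theorem isOrientation_edge {a b : V} (hab : a ≠ b) :
    IsOrientation (SimpleGraph.edge a b) ⟨fun u v => u = a ∧ v = b⟩ := by
  refine ⟨?_, ?_⟩
  · rintro u v ⟨rfl, rfl⟩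
    exact SimpleGraph.edge_adj _ _ _ _ |>.2 ⟨Or.inl ⟨rfl, rfl⟩, hab⟩
  · intro u v h
    obtain ⟨⟨rfl, rfl⟩ | ⟨rfl, rfl⟩, -⟩ := (SimpleGraph.edge_adj _ _ _ _).1 h
    · exact Or.inl ⟨⟨rfl, rfl⟩, fun h => hab h.1.symm⟩
    · exact Or.inr ⟨⟨rfl, rfl⟩, fun h => hab h.2⟩

theorem inDegree_arc (a b v : V) [Decidable (v = b)] :
    inDegree (⟨fun u v => u = a ∧ v = b⟩ : Digraph V) v = if v = b then 1 else 0 := by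
  rw [inDegree]
  split_ifs with h
  · simp [h]
  · simp [h]

theorem Realizes.symm {H : SimpleGraph V} {a b : V} {fa fb ca cb : ℕ}
    (h : Realizes H a b fa fb ca cb) : Realizes H b a fb fa cb ca := by
  obtain ⟨D, f, h1, h2, h3, h4, h5, h6, h7, h8⟩ := h
  exact ⟨D, f, h1, h2, fun x hx hb ha => h3 x hx ha hb, h4, h6, h5, h8, h7⟩

/-- The new edge is directed from `a` to `b`; the other direction follows through `Realizes.symm`.
-/
theorem Realizes.add_edge [Finite V] {H : SimpleGraph V} {a b : V} {fa fb ca cb : ℕ}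
    (h : Realizes H a b fa fb ca cb) (hab : a ≠ b) (hH : ¬ H.Adj a b) (hf : fa ≠ fb) :
    Realizes (H ⊔ SimpleGraph.edge a b) a b fa fb ca (cb + 1) := by
  classical
  obtain ⟨D, f, ho, hp, hi, hl, rfl, rfl, rfl, rfl⟩ := h
  have hdisj : ∀ u v, H.Adj u v → ¬ (SimpleGraph.edge a b).Adj u v := by
    intro u v h h'
    obtain ⟨⟨rfl, rfl⟩ | ⟨rfl, rfl⟩, -⟩ := (SimpleGraph.edge_adj _ _ _ _).1 h'
    exacts [hH h, hH h.symm]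
  have ho' := isOrientation_edge hab
  have hdeg := inDegree_sup (D₁ := D) (D₂ := ⟨fun u v => u = a ∧ v = b⟩)
    fun u v h h' => hdisj u v (ho.1 _ _ h) (ho'.1 _ _ h')
  simp only [inDegree_arc] at hdeg
  refine ⟨D ⊔ ⟨fun u v => u = a ∧ v = b⟩, f, isOrientation_sup ho ho' hdisj, ?_, ?_, hl, rfl, rfl,
    ?_, ?_⟩
  · rintro x y (h | h)
    · exact hp x y h
    · obtain ⟨⟨rfl, rfl⟩ | ⟨rfl, rfl⟩, -⟩ := (SimpleGraph.edge_adj _ _ _ _).1 h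
      exacts [hf, hf.symm]
  · rintro x ⟨y, h | h⟩ hxa hxb
    · rw [hdeg, if_neg hxb, add_zero, hi x ⟨y, h⟩ hxa hxb]
    · obtain ⟨⟨rfl, rfl⟩ | ⟨rfl, rfl⟩, -⟩ := (SimpleGraph.edge_adj _ _ _ _).1 h
      exacts [absurd rfl hxa, absurd rfl hxb]
  · rw [hdeg, if_neg hab, add_zero]
  · rw [hdeg, if_pos rfl]

/-- The bits of `R` encode quadruples of numbers `0, 1, 2, 3` which are all realized by `H`. -/
def Accepts (H : SimpleGraph V) (a b : V) (R : ℕ) : Prop :=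
  ∀ t < 256, R.testBit t = true → Realizes H a b (t / 64) (t / 16 % 4) (t / 4 % 4) (t % 4)

theorem Accepts.realizes {H : SimpleGraph V} {a b : V} {R : ℕ} (h : Accepts H a b R)
    {fa fb ca cb : ℕ} (h1 : fa < 4) (h2 : fb < 4) (h3 : ca < 4) (h4 : cb < 4)
    (hR : R.testBit (64 * fa + 16 * fb + 4 * ca + cb) = true) : Realizes H a b fa fb ca cb := by
  have := h _ (by omega) hR
  rwa [show (64 * fa + 16 * fb + 4 * ca + cb) / 64 = fa by omega,
    show (64 * fa + 16 * fb + 4 * ca + cb) / 16 % 4 = fb by omega,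
    show (64 * fa + 16 * fb + 4 * ca + cb) / 4 % 4 = ca by omega,
    show (64 * fa + 16 * fb + 4 * ca + cb) % 4 = cb by omega] at this

/-- All quadruples in `T` arise by series composition from `R` and `S`. -/
def seriesCovers (R S T : ℕ) : Bool :=
  (List.range 256).all fun t => !T.testBit t || (List.range 16).any fun u =>
    -- The number `u` codes the middle vertex: `u / 4` is its label, `u % 4` its in-degree from the
    -- first part, and the second part must supply the difference.
    u % 4 ≤ u / 4 && R.testBit (64 * (t / 64) + 16 * (u / 4) + 4 * (t / 4 % 4) + u % 4) &&
      S.testBit (64 * (u / 4) + 16 * (t / 16 % 4) + 4 * (u / 4 - u % 4) + t % 4)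

/-- All quadruples in `T` arise from `R` by adding an edge between the terminals. -/
def edgeCovers (R T : ℕ) : Bool :=
  (List.range 256).all fun t => !T.testBit t || (t / 64 != t / 16 % 4 &&
    ((1 ≤ t / 4 % 4 && R.testBit (64 * (t / 64) + 16 * (t / 16 % 4) + 4 * (t / 4 % 4 - 1) + t % 4))
    || (1 ≤ t % 4 && R.testBit (64 * (t / 64) + 16 * (t / 16 % 4) + 4 * (t / 4 % 4) + (t % 4 - 1)))))

theorem Accepts.series [Finite V] {H₁ H₂ : SimpleGraph V} {a m b : V} {R S T : ℕ}
    (h₁ : Accepts H₁ a m R) (h₂ : Accepts H₂ m b S) (hT : seriesCovers R S T = true)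
    (hm : ∀ x ∈ H₁.support, x ∈ H₂.support → x = m) (ha : a ∉ H₂.support) (hb : b ∉ H₁.support)
    (hab : a ≠ b) (ham : a ≠ m) : Accepts (H₁ ⊔ H₂) a b T := by
  intro t ht htT
  have := List.all_eq_true.1 hT t (List.mem_range.2 ht)
  simp only [htT, Bool.not_true, Bool.false_or, List.any_eq_true, Bool.and_eq_true,
    decide_eq_true_eq, List.mem_range] at this
  obtain ⟨u, hu, ⟨hle, hR⟩, hS⟩ := this
  exact (h₁.realizes (by omega) (by omega) (by omega) (by omega) hR).series
    (h₂.realizes (by omega) (by omega) (by omega) (by omega) hS) (by omega) hm ha hb hab ham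

theorem Accepts.add_edge [Finite V] {H : SimpleGraph V} {a b : V} {R T : ℕ}
    (h : Accepts H a b R) (hT : edgeCovers R T = true) (hab : a ≠ b) (hH : ¬ H.Adj a b) :
    Accepts (H ⊔ SimpleGraph.edge a b) a b T := by
  intro t ht htT
  have := List.all_eq_true.1 hT t (List.mem_range.2 ht)
  simp only [htT, Bool.not_true, Bool.false_or, Bool.or_eq_true, Bool.and_eq_true,
    decide_eq_true_eq, bne_iff_ne] at this
  obtain ⟨hne, ⟨h1, hR⟩ | ⟨h1, hR⟩⟩ := this
  · have := ((h.realizes (by omega) (by omega) (by omega) (by omega) hR).symm.add_edge hab.symm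
      (fun h => hH h.symm) hne.symm).symm
    rw [Nat.sub_add_cancel h1, SimpleGraph.edge_comm] at this
    exact this
  · have := (h.realizes (by omega) (by omega) (by omega) (by omega) hR).add_edge hab hH hne
    rwa [Nat.sub_add_cancel h1] at this

/-- The quadruples `(fa, fb, 0, 0)`. -/
def emptyCode : ℕ := 0x1000100010001000100010001000100010001000100010001000100010001

theorem accepts_bot {a b : V} (hab : a ≠ b) : Accepts (⊥ : SimpleGraph V) a b emptyCode := by
  classical
  intro t ht htT
  have h0 : t / 4 % 4 = 0 ∧ t % 4 = 0 := by
    have : (List.range 256).all (fun t => !emptyCode.testBit t ||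
        (t / 4 % 4 == 0 && t % 4 == 0)) = true := by decide +kernel
    simpa [htT] using List.all_eq_true.1 this t (List.mem_range.2 ht)
  have hd : ∀ x : V, inDegree (⟨fun _ _ => False⟩ : Digraph V) x = 0 := fun x => by
    simp [inDegree]
  refine ⟨⟨fun _ _ => False⟩, fun x => if x = a then t / 64 else t / 16 % 4,
    ⟨fun _ _ h => h.elim, fun _ _ h => h.elim⟩, fun _ _ h => h.elim, ?_, ?_, if_pos rfl,
    if_neg hab.symm, ?_, ?_⟩
  · rintro x ⟨y, h⟩
    exact h.elim
  · intro x
    dsimp only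
    split_ifs <;> omega
  · rw [hd, h0.1]
  · rw [hd, h0.2]

/-- Codes of the blocks between the ends of an edge: a single edge, or an edge that is also an edge
of a 5-cycle. -/
def blockCodes : List ℕ :=
  [0x1200120010001200000012001000120012000000100002000200020000,
   0x37603320110037600000320011000760064000000100006000600020000]

/-- Codes of series compositions of two blocks. -/
def pairCodes : List ℕ :=
  [0x33003200210011003200320020001000210020002100010003000200010001,
   0x77006400320011007600670023001100770063003300110007000700030001,
   0x333033203330111032003310231011100320031003300110003000300030001,
   0x777066403320111076007770333011100760077003300110007000700030001]

/-- Codes of series compositions of at least three blocks. -/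
def pathCodes : List ℕ :=
  [0x33002300330011003100200031001100330023001200110003000300030001,
   0x77007700330011007700730033001100770076003200110007000700030001,
   0x32003300330011003300330033001100330033003300110003000300030001,
   0x333033303330111033302330332011100330033003200110003000300030001,
   0x776077703330111077707760333011100770077003300110007000700030001,
   0x33003300330011003300330032001100330032003300110003000300030001,
   0x77007700330011007700760032001100770077003300110007000700030001,
   0x333033303330111033303320333011100330032003300110003000300030001]

/-- This check and the next three show that the lists of codes suffice for the recursion. A code is
only a lower bound, so inclusion is enough, and this keeps the lists finite. Closing a pair code by
an edge is not covered, since it would create a triangle. -/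
theorem edgeCovers_emptyCode : ∃ e ∈ blockCodes, edgeCovers emptyCode e = true := by
  decide +kernel

theorem seriesCovers_block_block : ∀ e ∈ blockCodes, ∀ e' ∈ blockCodes, ∃ s ∈ pairCodes,
    seriesCovers e e' s = true := by
  decide +kernel

theorem seriesCovers_block_path : ∀ e ∈ blockCodes, ∀ s ∈ pairCodes ++ pathCodes,
    ∃ s' ∈ pathCodes, seriesCovers e s s' = true := by
  decide +kernel

theorem edgeCovers_path : ∀ s ∈ pathCodes, ∃ e ∈ blockCodes, edgeCovers s e = true := by
  decide +kernel

/-- Such a quadruple makes the terminals consistent too, so the labelling of the block consists of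
genuine in-degrees. -/
theorem block_closes : ∀ e ∈ blockCodes, ∃ t < 256, e.testBit t = true ∧ t / 64 = t / 4 % 4 ∧
    t / 16 % 4 = t % 4 := by
  decide +kernel

end Terminals

/-! ### Proper orientations along a Hamiltonian cycle without crossing chords -/

section Recursion

variable {V : Type*} {G : SimpleGraph V} {n : ℕ} {c : ℕ → V}

/-- The subgraph of `G` on the vertices `c i, …, c j`. -/
def intervalGraph (G : SimpleGraph V) (c : ℕ → V) (i j : ℕ) : SimpleGraph V where
  Adj x y := G.Adj x y ∧ x ∈ c '' Set.Icc i j ∧ y ∈ c '' Set.Icc i j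
  symm := ⟨fun _ _ h => ⟨h.1.symm, h.2.2, h.2.1⟩⟩
  loopless := ⟨fun _ h => h.1.ne rfl⟩

theorem mem_of_mem_support_intervalGraph {i j : ℕ} {x : V}
    (hx : x ∈ (intervalGraph G c i j).support) : x ∈ c '' Set.Icc i j := by
  obtain ⟨y, h⟩ := hx
  exact h.2.1

namespace IsHamiltonianOrder

theorem intervalGraph_succ (h : IsHamiltonianOrder G n c) {i : ℕ} (hi : i + 1 < n) :
    intervalGraph G c i (i + 1) = ⊥ ⊔ SimpleGraph.edge (c i) (c (i + 1)) := by
  ext x y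
  rw [bot_sup_eq, SimpleGraph.edge_adj]
  constructor
  · rintro ⟨hxy, ⟨k, ⟨hk1, hk2⟩, rfl⟩, ⟨l, ⟨hl1, hl2⟩, rfl⟩⟩
    refine ⟨?_, hxy.ne⟩
    obtain rfl | rfl : k = i ∨ k = i + 1 := by omega
    · obtain rfl | rfl : l = k ∨ l = k + 1 := by omega
      · exact absurd rfl hxy.ne
      · exact Or.inl ⟨rfl, rfl⟩
    · obtain rfl | rfl : l = i ∨ l = i + 1 := by omega
      · exact Or.inr ⟨rfl, rfl⟩
      · exact absurd rfl hxy.ne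
  · have hadj := h.adj_succ i hi
    have h1 : c i ∈ c '' Set.Icc i (i + 1) := ⟨i, ⟨le_rfl, by omega⟩, rfl⟩
    have h2 : c (i + 1) ∈ c '' Set.Icc i (i + 1) := ⟨i + 1, ⟨by omega, le_rfl⟩, rfl⟩
    rintro ⟨⟨rfl, rfl⟩ | ⟨rfl, rfl⟩, -⟩
    exacts [⟨hadj, h1, h2⟩, ⟨hadj.symm, h2, h1⟩]

/-- Splitting an interval at the last neighbour of its first vertex. -/
theorem exists_split (h : IsHamiltonianOrder G n c)
    (hcross : ∀ i j k l, i < j → j < k → k < l → l < n → G.Adj (c i) (c k) →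
      ¬ G.Adj (c j) (c l)) {i j : ℕ} (hij : i + 1 < j) (hj : j < n) :
    ∃ m, i < m ∧ m < j ∧ G.Adj (c i) (c m) ∧
      ∀ x y, ((intervalGraph G c i m ⊔ intervalGraph G c m j).Adj x y ↔
        (intervalGraph G c i j).Adj x y ∧ ¬ (x = c i ∧ y = c j) ∧ ¬ (x = c j ∧ y = c i)) := by
  classical
  obtain ⟨m, ⟨him, hmj, hadj⟩, hmax⟩ : ∃ m, (i < m ∧ m < j ∧ G.Adj (c i) (c m)) ∧
      ∀ k, i < k ∧ k < j ∧ G.Adj (c i) (c k) → k ≤ m := by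
    have hfin : {k | i < k ∧ k < j ∧ G.Adj (c i) (c k)}.Finite :=
      (Set.finite_lt_nat j).subset fun k hk => hk.2.1
    obtain ⟨m, hm⟩ := hfin.exists_maximal ⟨i + 1, by omega, hij, h.adj_succ i (by omega)⟩
    exact ⟨m, hm.1, fun k hk => le_of_not_gt fun hlt => (hm.2 hk hlt.le).not_gt hlt⟩
  refine ⟨m, him, hmj, hadj, ?_⟩
  -- An edge jumping over `m` would cross the chord from `c i` to `c m` or, if it starts at `c i`,
  -- contradict the maximality of `m`, unless it joins `c i` and `c j`.
  have hno : ∀ k l, i ≤ k → k < m → m < l → l ≤ j → G.Adj (c k) (c l) → k = i ∧ l = j := by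
    intro k l hk hkm hml hl hkl
    rcases hk.eq_or_lt with rfl | hk
    · refine ⟨rfl, le_antisymm hl (le_of_not_gt fun hlt => ?_)⟩
      have := hmax l ⟨by omega, hlt, hkl⟩
      omega
    · exact absurd hkl (hcross i k m l hk hkm hml (by omega) hadj)
  intro x y
  constructor
  · rintro (⟨hxy, ⟨k, ⟨hk1, hk2⟩, rfl⟩, ⟨l, ⟨hl1, hl2⟩, rfl⟩⟩ |
      ⟨hxy, ⟨k, ⟨hk1, hk2⟩, rfl⟩, ⟨l, ⟨hl1, hl2⟩, rfl⟩⟩)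
    · refine ⟨⟨hxy, ⟨k, ⟨hk1, by omega⟩, rfl⟩, ⟨l, ⟨hl1, by omega⟩, rfl⟩⟩, ?_, ?_⟩
      · rintro ⟨-, h2⟩; have := h.inj _ _ (by omega) hj h2; omega
      · rintro ⟨h2, -⟩; have := h.inj _ _ (by omega) hj h2; omega
    · refine ⟨⟨hxy, ⟨k, ⟨by omega, by omega⟩, rfl⟩, ⟨l, ⟨by omega, by omega⟩, rfl⟩⟩, ?_, ?_⟩
      · rintro ⟨h2, -⟩; have := h.inj _ _ (by omega) (by omega) h2; omega
      · rintro ⟨-, h2⟩; have := h.inj _ _ (by omega) (by omega) h2; omega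
  · rintro ⟨⟨hxy, ⟨k, ⟨hk1, hk2⟩, rfl⟩, ⟨l, ⟨hl1, hl2⟩, rfl⟩⟩, hn1, hn2⟩
    rcases le_or_gt k m with hkm | hkm <;> rcases le_or_gt l m with hlm | hlm
    · exact Or.inl ⟨hxy, ⟨k, ⟨hk1, hkm⟩, rfl⟩, ⟨l, ⟨hl1, hlm⟩, rfl⟩⟩
    · rcases hkm.eq_or_lt with rfl | hkm
      · exact Or.inr ⟨hxy, ⟨k, ⟨le_rfl, hk2⟩, rfl⟩, ⟨l, ⟨hlm.le, hl2⟩, rfl⟩⟩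
      · obtain ⟨rfl, rfl⟩ := hno k l hk1 hkm hlm hl2 hxy
        exact absurd ⟨rfl, rfl⟩ hn1
    · rcases hlm.eq_or_lt with rfl | hlm
      · exact Or.inr ⟨hxy, ⟨k, ⟨hkm.le, hk2⟩, rfl⟩, ⟨l, ⟨le_rfl, hl2⟩, rfl⟩⟩
      · obtain ⟨rfl, rfl⟩ := hno l k hl1 hlm hkm hk2 hxy.symm
        exact absurd ⟨rfl, rfl⟩ hn2
    · exact Or.inr ⟨hxy, ⟨k, ⟨hkm.le, hk2⟩, rfl⟩, ⟨l, ⟨hlm.le, hl2⟩, rfl⟩⟩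

theorem accepts_series [Finite V] (h : IsHamiltonianOrder G n c) {i m j : ℕ} (him : i < m)
    (hmj : m < j) (hj : j < n) {R S T : ℕ} (h₁ : Accepts (intervalGraph G c i m) (c i) (c m) R)
    (h₂ : Accepts (intervalGraph G c m j) (c m) (c j) S) (hT : seriesCovers R S T = true) :
    Accepts (intervalGraph G c i m ⊔ intervalGraph G c m j) (c i) (c j) T := by
  refine h₁.series h₂ hT ?_ ?_ ?_ ?_ ?_
  · intro x hx hx'
    obtain ⟨k, ⟨hk1, hk2⟩, rfl⟩ := mem_of_mem_support_intervalGraph hx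
    obtain ⟨l, ⟨hl1, hl2⟩, hkl⟩ := mem_of_mem_support_intervalGraph hx'
    have := h.inj _ _ (by omega) (by omega) hkl
    rw [show k = m by omega]
  · intro hx
    obtain ⟨l, ⟨hl1, hl2⟩, hkl⟩ := mem_of_mem_support_intervalGraph hx
    have := h.inj _ _ (by omega) (by omega) hkl
    omega
  · intro hx
    obtain ⟨l, ⟨hl1, hl2⟩, hkl⟩ := mem_of_mem_support_intervalGraph hx
    have := h.inj _ _ (by omega) (by omega) hkl
    omega
  · intro hx
    have := h.inj _ _ (by omega) (by omega) hx
    omega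
  · intro hx
    have := h.inj _ _ (by omega) (by omega) hx
    omega

/-- Induction on `j - i` with the split at the last neighbour `c m` of `c i` before `c j`: the left
part is always a block, and the right part is a block or a composition according to whether `c m`
and `c j` are adjacent. -/
theorem exists_accepts [Finite V] (h : IsHamiltonianOrder G n c) (htf : G.CliqueFree 3)
    (hcross : ∀ i j k l, i < j → j < k → k < l → l < n → G.Adj (c i) (c k) →
      ¬ G.Adj (c j) (c l)) {i j : ℕ} (hij : i < j) (hj : j < n) :
    (G.Adj (c i) (c j) → ∃ e ∈ blockCodes, Accepts (intervalGraph G c i j) (c i) (c j) e) ∧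
    (¬ G.Adj (c i) (c j) →
      ∃ s ∈ pairCodes ++ pathCodes, Accepts (intervalGraph G c i j) (c i) (c j) s) := by
  obtain ⟨d, hd⟩ : ∃ d, d = j - i := ⟨_, rfl⟩
  induction d using Nat.strong_induction_on generalizing i j with
  | _ d ih =>
  have hne : c i ≠ c j := fun e => by have := h.inj _ _ (by omega) hj e; omega
  rcases (show i + 1 ≤ j from hij).eq_or_lt with rfl | hij'
  · refine ⟨fun _ => ?_, fun hn => absurd (h.adj_succ i hj) hn⟩
    obtain ⟨e, he, hcov⟩ := edgeCovers_emptyCode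
    refine ⟨e, he, ?_⟩
    rw [h.intervalGraph_succ hj]
    exact (accepts_bot hne).add_edge hcov hne id
  · obtain ⟨m, him, hmj, hadj, hsplit⟩ := h.exists_split hcross hij' hj
    obtain ⟨e, he, heacc⟩ := (ih (m - i) (by omega) him (by omega) rfl).1 hadj
    have hsup : ¬ G.Adj (c i) (c j) →
        intervalGraph G c i m ⊔ intervalGraph G c m j = intervalGraph G c i j := by
      intro hn
      ext x y
      rw [hsplit, and_iff_left_iff_imp]
      rintro ⟨hxy, -⟩
      constructor
      · rintro ⟨rfl, rfl⟩; exact hn hxy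
      · rintro ⟨rfl, rfl⟩; exact hn hxy.symm
    have hnadj : ¬ (intervalGraph G c i m ⊔ intervalGraph G c m j).Adj (c i) (c j) := by
      rw [hsplit]
      exact fun e => e.2.1 ⟨rfl, rfl⟩
    have hsup' : G.Adj (c i) (c j) → intervalGraph G c i m ⊔ intervalGraph G c m j ⊔
        SimpleGraph.edge (c i) (c j) = intervalGraph G c i j := by
      intro hij''
      have h1 : c i ∈ c '' Set.Icc i j := ⟨i, ⟨le_rfl, by omega⟩, rfl⟩
      have h2 : c j ∈ c '' Set.Icc i j := ⟨j, ⟨by omega, le_rfl⟩, rfl⟩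
      ext x y
      rw [SimpleGraph.sup_adj, hsplit, SimpleGraph.edge_adj]
      constructor
      · rintro (hxy | ⟨⟨rfl, rfl⟩ | ⟨rfl, rfl⟩, -⟩)
        exacts [hxy.1, ⟨hij'', h1, h2⟩, ⟨hij''.symm, h2, h1⟩]
      · intro hxy
        by_cases e1 : x = c i ∧ y = c j
        · exact Or.inr ⟨Or.inl e1, hxy.1.ne⟩
        by_cases e2 : x = c j ∧ y = c i
        · exact Or.inr ⟨Or.inr e2, hxy.1.ne⟩
        exact Or.inl ⟨hxy, e1, e2⟩
    obtain ⟨ih1, ih2⟩ := ih (j - m) (by omega) hmj hj rfl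
    by_cases hmj' : G.Adj (c m) (c j)
    · have hn : ¬ G.Adj (c i) (c j) := fun hij'' => by
        classical
        exact htf {c i, c m, c j} (SimpleGraph.is3Clique_triple_iff.2 ⟨hadj, hij'', hmj'⟩)
      obtain ⟨e', he', he'acc⟩ := ih1 hmj'
      obtain ⟨s, hs, hcov⟩ := seriesCovers_block_block e he e' he'
      refine ⟨fun hij'' => absurd hij'' hn, fun _ => ⟨s, List.mem_append_left _ hs, ?_⟩⟩
      rw [← hsup hn]
      exact h.accepts_series him hmj hj heacc he'acc hcov
    · obtain ⟨s, hs, hsacc⟩ := ih2 hmj'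
      obtain ⟨s', hs', hcov⟩ := seriesCovers_block_path e he s hs
      have hacc := h.accepts_series him hmj hj heacc hsacc hcov
      constructor
      · intro hij''
        obtain ⟨e', he', hcov'⟩ := edgeCovers_path s' hs'
        refine ⟨e', he', ?_⟩
        rw [← hsup' hij'']
        exact hacc.add_edge hcov' hne hnadj
      · intro hn
        refine ⟨s', List.mem_append_right _ hs', ?_⟩
        rw [← hsup hn]
        exact hacc

/-- The closing edge of the Hamiltonian cycle makes the whole graph a block with terminals `c 0` and
`c (n - 1)`. -/
theorem exists_isProperKOrientation [Finite V] (h : IsHamiltonianOrder G n c)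
    (htf : G.CliqueFree 3) (hcross : ∀ i j k l, i < j → j < k → k < l → l < n →
      G.Adj (c i) (c k) → ¬ G.Adj (c j) (c l)) : ∃ D, IsProperKOrientation G 3 D := by
  have h3 := h.three_le
  obtain ⟨e, he, hacc⟩ := (h.exists_accepts htf hcross (i := 0) (j := n - 1) (by omega)
    (by omega)).1 h.adj_last.symm
  have hG : intervalGraph G c 0 (n - 1) = G := by
    ext x y
    refine ⟨fun hxy => hxy.1, fun hxy => ⟨hxy, ?_, ?_⟩⟩
    · obtain ⟨k, hk, rfl⟩ := h.surj x
      exact ⟨k, ⟨by omega, by omega⟩, rfl⟩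
    · obtain ⟨k, hk, rfl⟩ := h.surj y
      exact ⟨k, ⟨by omega, by omega⟩, rfl⟩
  rw [hG] at hacc
  obtain ⟨t, ht, hbit, h1, h2⟩ := block_closes e he
  obtain ⟨D, f, ho, hp, hi, hl, hfa, hfb, hca, hcb⟩ := hacc t ht hbit
  have hdeg : ∀ x, inDegree D x = f x := by
    intro x
    by_cases hxa : x = c 0
    · rw [hxa, hfa, hca, h1]
    by_cases hxb : x = c (n - 1)
    · rw [hxb, hfb, hcb, h2]
    refine hi x ?_ hxa hxb
    obtain ⟨k, hk, rfl⟩ := h.surj x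
    have : k ≠ n - 1 := fun e => hxb (by rw [e])
    exact ⟨c (k + 1), h.adj_succ k (by omega)⟩
  refine ⟨D, ⟨ho, fun u v huv => ?_⟩, fun v => ?_⟩
  · rw [hdeg, hdeg]; exact hp u v huv
  · rw [hdeg]; exact hl v

end IsHamiltonianOrder

/-- Triangle-free 2-connected outerplanar graphs have proper orientations with in-degrees at
most 3. -/
theorem properOrientationNumber_le_three [Finite V] (htf : G.CliqueFree 3)
    (h2 : IsTwoConnected G) (hop : IsOuterplanar G) : properOrientationNumber G ≤ 3 := by
  obtain ⟨E, F, hF, hv⟩ := hop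
  have hth := E.not_hasTheta hF hv
  obtain ⟨n, c, h⟩ := exists_isHamiltonianOrder h2 hth
  exact iInf₂_le 3 (h.exists_isProperKOrientation htf
    fun i j k l hij hjk hkl hl => h.not_crossing hth htf hij hjk hkl hl)

end Recursion

/-! ### Graphs drawn with straight edges between points of a parabola -/

section Parabola

variable {V : Type*} {G : SimpleGraph V}

/-- The point of the standard parabola with abscissa `k`. -/
def parabolaPoint (k : ℝ) : ℝ × ℝ := (k, k ^ 2)

theorem parabolaPoint_injective : Function.Injective parabolaPoint :=
  fun _ _ h => congrArg Prod.fst h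

/-- The product `(x - a) * (b - x)` is the height of the chord above the parabola at abscissa `x`,
so intersections of chords become equalities of heights. -/
theorem mem_segment_parabola {a b : ℝ} {z : ℝ × ℝ}
    (hz : z ∈ segment ℝ (parabolaPoint a) (parabolaPoint b)) :
    z.2 = z.1 ^ 2 + (z.1 - a) * (b - z.1) ∧ 0 ≤ (z.1 - a) * (b - z.1) := by
  rw [segment_eq_image_lineMap] at hz
  obtain ⟨t, ⟨ht0, ht1⟩, rfl⟩ := hz
  have h1 : (AffineMap.lineMap (parabolaPoint a) (parabolaPoint b) t : ℝ × ℝ).1 =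
      a + t * (b - a) := by
    simp [parabolaPoint, AffineMap.lineMap_apply]; ring
  have h2 : (AffineMap.lineMap (parabolaPoint a) (parabolaPoint b) t : ℝ × ℝ).2 =
      a ^ 2 + t * (b ^ 2 - a ^ 2) := by
    simp [parabolaPoint, AffineMap.lineMap_apply]; ring
  rw [h1, h2]
  refine ⟨by ring, ?_⟩
  have : (a + t * (b - a) - a) * (b - (a + t * (b - a))) = t * (1 - t) * (b - a) ^ 2 := by ring
  rw [this]
  have : 0 ≤ 1 - t := by linarith
  positivity

theorem mem_Icc_of_mul_nonneg {a b x : ℝ} (hab : a < b) (h : 0 ≤ (x - a) * (b - x)) :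
    a ≤ x ∧ x ≤ b := by
  constructor <;> by_contra! h' <;> nlinarith

theorem eq_ends_of_not_crossing {a b c d x : ℝ} (hab : a < b) (hcd : c < d)
    (h₁ : 0 ≤ (x - a) * (b - x)) (h₂ : (x - a) * (b - x) = (x - c) * (d - x))
    (hne : ¬ (a = c ∧ b = d)) (hn : ¬ (a < c ∧ c < b ∧ b < d)) (hn' : ¬ (c < a ∧ a < d ∧ d < b)) :
    (x = a ∨ x = b) ∧ (x = c ∨ x = d) := by
  obtain ⟨hax, hxb⟩ := mem_Icc_of_mul_nonneg hab h₁
  obtain ⟨hcx, hxd⟩ := mem_Icc_of_mul_nonneg hcd (h₂ ▸ h₁)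
  -- The difference of the heights is `(x - a) * (b - d) + (c - a) * (d - x)`, a sum of nonnegative
  -- terms, so both vanish.
  have nested : ∀ {a b c d : ℝ}, a < c → d ≤ b → c ≤ x → x ≤ d →
      (x - a) * (b - x) = (x - c) * (d - x) → x = b ∧ x = d := by
    intro a b c d hac hdb hcx hxd h
    have hd : x = d := by
      by_contra hd
      have : x < d := lt_of_le_of_ne hxd hd
      nlinarith [mul_nonneg (sub_nonneg.2 (hac.le.trans hcx)) (sub_nonneg.2 hdb),
        mul_pos (sub_pos.2 hac) (sub_pos.2 this)]
    refine ⟨?_, hd⟩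
    rw [← hd, sub_self, mul_zero, mul_eq_zero] at h
    rcases h with h | h <;> linarith
  rcases le_or_gt b c with hbc | hbc
  · exact ⟨Or.inr (by linarith), Or.inl (by linarith)⟩
  rcases le_or_gt d a with hda | hda
  · exact ⟨Or.inl (by linarith), Or.inr (by linarith)⟩
  rcases lt_trichotomy a c with hac | rfl | hac
  · have hdb : d ≤ b := le_of_not_gt fun h => hn ⟨hac, hbc, h⟩
    obtain ⟨e1, e2⟩ := nested hac hdb hcx hxd h₂
    exact ⟨Or.inr e1, Or.inr e2⟩
  · have : (x - a) * (b - d) = 0 := by linarith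
    rcases mul_eq_zero.1 this with h | h
    · exact ⟨Or.inl (by linarith), Or.inl (by linarith)⟩
    · exact absurd ⟨rfl, by linarith⟩ hne
  · have hdb : b ≤ d := le_of_not_gt fun h => hn' ⟨hac, hda, h⟩
    obtain ⟨e1, e2⟩ := nested hac hdb hax hxb h₂.symm
    exact ⟨Or.inr e2, Or.inr e1⟩

/-- The drawing of `G` in which the vertex `v` is the point of the parabola with abscissa `k v` and
the edges are straight. -/
def parabolaEmbedding (G : SimpleGraph V) (k : V → ℝ) (hk : Function.Injective k)
    (hcross : ∀ u v, G.Adj u v → ∀ u' v', G.Adj u' v' →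
      ¬ (k u < k u' ∧ k u' < k v ∧ k v < k v')) : PlaneEmbedding G where
  point v := parabolaPoint (k v)
  arc e := {z | ∃ u v, (e : Sym2 V) = s(u, v) ∧
    z ∈ segment ℝ (parabolaPoint (k u)) (parabolaPoint (k v))}
  point_injective := parabolaPoint_injective.comp hk
  isArc u v h := by
    refine ⟨⟨⟨fun t => AffineMap.lineMap (parabolaPoint (k u)) (parabolaPoint (k v)) (t : ℝ),
      AffineMap.lineMap_continuous.comp continuous_subtype_val⟩, by simp, by simp⟩, ?_, ?_⟩
    · intro s t hst
      exact Subtype.ext (AffineMap.lineMap_injective ℝ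
        (fun e => h.ne (hk (parabolaPoint_injective e))) hst)
    · have : {z | ∃ a b, s(u, v) = s(a, b) ∧
          z ∈ segment ℝ (parabolaPoint (k a)) (parabolaPoint (k b))} =
          segment ℝ (parabolaPoint (k u)) (parabolaPoint (k v)) := by
        ext z
        constructor
        · rintro ⟨a, b, hab, hz⟩
          rcases Sym2.eq_iff.1 hab with ⟨rfl, rfl⟩ | ⟨rfl, rfl⟩
          · exact hz
          · rwa [segment_symm]
        · exact fun hz => ⟨u, v, rfl, hz⟩
      refine Eq.trans ?_ this.symm
      rw [segment_eq_image_lineMap]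
      ext z
      constructor
      · rintro ⟨t, rfl⟩; exact ⟨t, t.2, rfl⟩
      · rintro ⟨t, ht, rfl⟩; exact ⟨⟨t, ht⟩, rfl⟩
  mem_of_point_mem_arc := by
    rintro ⟨e, he⟩ w ⟨u, v, rfl, hz⟩
    have := (mem_segment_parabola hz).1
    simp only [parabolaPoint, left_eq_add, mul_eq_zero] at this
    rcases this with h | h
    · exact hk (sub_eq_zero.1 h) ▸ Sym2.mem_mk_left _ _
    · exact hk (sub_eq_zero.1 h) ▸ Sym2.mem_mk_right _ _
  arc_inter_arc := by
    have key : ∀ e : G.edgeSet, ∀ z, (∃ u v, (e : Sym2 V) = s(u, v) ∧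
        z ∈ segment ℝ (parabolaPoint (k u)) (parabolaPoint (k v))) →
        ∃ u v, (e : Sym2 V) = s(u, v) ∧ G.Adj u v ∧ k u < k v ∧
          z ∈ segment ℝ (parabolaPoint (k u)) (parabolaPoint (k v)) := by
      rintro ⟨e, he⟩ z ⟨u, v, rfl, hz⟩
      have hadj : G.Adj u v := he
      rcases lt_or_gt_of_ne (fun e => hadj.ne (hk e) : k u ≠ k v) with h | h
      · exact ⟨u, v, rfl, hadj, h, hz⟩
      · exact ⟨v, u, Sym2.eq_swap, hadj.symm, h, by rwa [segment_symm]⟩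
    rintro e f hef z ⟨hze, hzf⟩
    obtain ⟨u, v, he, huv, hlt, hz⟩ := key e z hze
    obtain ⟨u', v', hf, huv', hlt', hz'⟩ := key f z hzf
    obtain ⟨h1, h2⟩ := mem_segment_parabola hz
    obtain ⟨h1', -⟩ := mem_segment_parabola hz'
    obtain ⟨h3, h4⟩ := eq_ends_of_not_crossing hlt hlt' h2 (by linarith)
      (by
        rintro ⟨e1, e2⟩
        apply hef
        apply Subtype.ext
        rw [he, hf, hk e1, hk e2]) (hcross u v huv u' v' huv') (hcross u' v' huv' u v huv)
    obtain ⟨w, hw, hwx⟩ : ∃ w ∈ s(u, v), k w = z.1 := by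
      rcases h3 with h | h
      exacts [⟨u, Sym2.mem_mk_left _ _, h.symm⟩, ⟨v, Sym2.mem_mk_right _ _, h.symm⟩]
    refine ⟨w, he ▸ hw, ?_, ?_⟩
    · rw [hf]
      rcases h4 with h | h
      · exact hk (hwx.trans h) ▸ Sym2.mem_mk_left _ _
      · exact hk (hwx.trans h) ▸ Sym2.mem_mk_right _ _
    · refine Prod.ext hwx ?_
      change k w ^ 2 = z.2
      rw [h1, hwx]
      rcases h3 with h | h <;> rw [h] <;> ring

/-- The drawing lies on or above the parabola. The region strictly below it is connected, hence
contained in one face, and has all vertices in its closure. -/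
theorem isOuterplanar_of_not_crossing (k : V → ℝ) (hk : Function.Injective k)
    (hcross : ∀ u v, G.Adj u v → ∀ u' v', G.Adj u' v' →
      ¬ (k u < k u' ∧ k u' < k v ∧ k v < k v')) : IsOuterplanar G := by
  let E := parabolaEmbedding G k hk hcross
  have hcar : ∀ z ∈ E.carrier, z.1 ^ 2 ≤ z.2 := by
    rintro z (⟨v, rfl⟩ | hz)
    · exact le_rfl
    · obtain ⟨e, u, v, -, hz⟩ := Set.mem_iUnion.1 hz
      obtain ⟨h1, h2⟩ := mem_segment_parabola hz
      linarith
  let B : Set (ℝ × ℝ) := {z | z.2 < z.1 ^ 2}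
  have hB : B ⊆ E.carrierᶜ := fun z hz hz' => absurd (hcar z hz') (not_le.2 hz)
  have hBc : IsPreconnected B := by
    -- The region below the parabola is the continuous image of a half-plane.
    have himg : B = (fun z : ℝ × ℝ => (z.1, z.1 ^ 2 - z.2)) '' (Set.univ ×ˢ Set.Ioi 0) := by
      ext ⟨x, y⟩
      constructor
      · intro h
        exact ⟨(x, x ^ 2 - y), ⟨trivial, Set.mem_Ioi.2 (sub_pos.2 h)⟩, by simp⟩
      · rintro ⟨⟨a, b⟩, ⟨-, hb⟩, hab⟩
        simp only [Prod.mk.injEq] at hab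
        obtain ⟨rfl, rfl⟩ := hab
        exact sub_lt_self _ (Set.mem_Ioi.1 hb)
    rw [himg]
    exact ((convex_univ.prod (convex_Ioi 0)).isPreconnected).image _ (by fun_prop)
  have h0 : ((0, -1) : ℝ × ℝ) ∈ B := by change (-1 : ℝ) < 0 ^ 2; norm_num
  refine ⟨E, connectedComponentIn E.carrierᶜ (0, -1), ⟨_, hB h0, rfl⟩, fun v => ?_⟩
  have hBF : B ⊆ connectedComponentIn E.carrierᶜ (0, -1) :=
    hBc.subset_connectedComponentIn h0 hB
  refine ⟨closure_mono hBF ?_, fun h => ?_⟩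
  · have hlim : Filter.Tendsto (fun ε : ℝ => ((k v, k v ^ 2 - ε) : ℝ × ℝ))
        (nhdsWithin 0 (Set.Ioi 0)) (nhds (E.point v)) := by
      have : Continuous fun ε : ℝ => ((k v, k v ^ 2 - ε) : ℝ × ℝ) := by fun_prop
      have h := (this.tendsto 0).mono_left (nhdsWithin_le_nhds (s := Set.Ioi 0))
      simpa [E, parabolaEmbedding, parabolaPoint] using h
    refine mem_closure_of_tendsto hlim (Filter.eventually_of_mem self_mem_nhdsWithin ?_)
    intro ε hε
    exact sub_lt_self _ (Set.mem_Ioi.1 hε)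
  · exact connectedComponentIn_subset _ _ (interior_subset h) (Or.inl ⟨v, rfl⟩)

end Parabola

/-! ### 2-connectedness of Hamiltonian graphs. -/

theorem LinkedIn.reachable_induce {V : Type*} {G : SimpleGraph V} {S : Set V} {u v : V}
    (h : LinkedIn G S u v) (hu : u ∈ S) (hv : v ∈ S) :
    (G.induce S).Reachable ⟨u, hu⟩ ⟨v, hv⟩ := by
  obtain ⟨p, hp⟩ := h
  exact ⟨p.induce S hp⟩

theorem IsHamiltonianOrder.isTwoConnected {V : Type*} {G : SimpleGraph V} {n : ℕ} {c : ℕ → V}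
    (h : IsHamiltonianOrder G n c) (hV : 3 ≤ Nat.card V) : IsTwoConnected G := by
  have h3 := h.three_le
  refine ⟨hV, ?_, fun v => ?_⟩
  · have : Nonempty V := ⟨c 0⟩
    refine SimpleGraph.connected_iff_exists_forall_reachable _ |>.2 ⟨c 0, fun w => ?_⟩
    obtain ⟨j, hj, rfl⟩ := h.surj w
    obtain ⟨p, -⟩ := h.linkedIn_Icc (Nat.zero_le j) hj
    exact ⟨p⟩
  · obtain ⟨i, hi, rfl⟩ := h.surj v
    have hsub : ∀ a b, b < n → i ∉ Set.Icc a b → c '' Set.Icc a b ⊆ {c i}ᶜ := by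
      rintro a b hb hi' _ ⟨m, hm, rfl⟩ hmi
      have := h.inj m i (lt_of_le_of_lt hm.2 hb) hi hmi
      exact hi' (this ▸ hm)
    have hmem : ∀ j < n, j ≠ i → c j ∈ ({c i}ᶜ : Set V) := fun j hj hji hji' =>
      hji (h.inj j i hj hi hji')
    -- What remains of the cycle is a path, and all its vertices are linked to `c (n - 1)`, or to `c
    -- 0` if `c (n - 1)` is the deleted vertex.
    obtain ⟨r, hr, hri, hlink⟩ : ∃ r < n, r ≠ i ∧ ∀ j < n, j ≠ i →
        LinkedIn G {c i}ᶜ (c r) (c j) := by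
      by_cases hin : i = n - 1
      · refine ⟨0, by omega, by omega, fun j hj hji => ?_⟩
        exact (h.linkedIn_Icc (Nat.zero_le j) hj).mono
          (hsub _ _ hj (by simp only [Set.mem_Icc]; omega))
      · refine ⟨n - 1, by omega, fun e => hin e.symm, fun j hj hji => ?_⟩
        rcases lt_or_gt_of_ne hji with hlt | hlt
        · refine (LinkedIn.of_adj h.adj_last (hmem _ (by omega) (by omega))
            (hmem _ (by omega) (by omega))).trans ((h.linkedIn_Icc (Nat.zero_le j) hj).mono
            (hsub _ _ hj (by simp only [Set.mem_Icc]; omega)))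
        · exact ((h.linkedIn_Icc (i := j) (j := n - 1) (by omega) (by omega)).mono
            (hsub _ _ (by omega) (by simp only [Set.mem_Icc]; omega))).symm
    refine SimpleGraph.connected_iff_exists_forall_reachable _ |>.2
      ⟨⟨c r, hmem r hr hri⟩, fun w => ?_⟩
    obtain ⟨w, hw⟩ := w
    obtain ⟨j, hj, rfl⟩ := h.surj w
    exact (hlink j hj fun e => hw (by rw [e]; rfl)).reachable_induce _ _

/-! ### The 5-cycle with a path of length 4 attached to each edge -/

section FiveCycle

instance decidableRelFiveCycleWithPaths : DecidableRel fiveCycleWithPaths.Adj :=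
  fun u v => decidable_of_iff _ (SimpleGraph.fromRel_adj _ u v).symm

theorem fiveCycleWithPaths_cliqueFree : fiveCycleWithPaths.CliqueFree 3 := by
  have key : ∀ a b, fiveCycleWithPaths.Adj a b → ∀ c, fiveCycleWithPaths.Adj a c →
      ¬ fiveCycleWithPaths.Adj b c := by decide +kernel
  intro s hs
  obtain ⟨a, b, c, hab, hac, hbc, -⟩ := SimpleGraph.is3Clique_iff.1 hs
  exact key a b hab c hac hbc

/-- The vertices of `fiveCycleWithPaths` along its Hamiltonian cycle. -/
def fiveCycleOrder (m : ℕ) : Fin 5 × Fin 4 := (Fin.ofNat 5 (m / 4), Fin.ofNat 4 m)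

theorem isHamiltonianOrder_fiveCycleWithPaths :
    IsHamiltonianOrder fiveCycleWithPaths 20 fiveCycleOrder where
  three_le := by norm_num
  inj := by
    have : ∀ i < 20, ∀ j < 20, fiveCycleOrder i = fiveCycleOrder j → i = j := by decide +kernel
    exact fun i j hi hj => this i hi j hj
  surj := by decide +kernel
  adj_succ := by
    have : ∀ i < 19, fiveCycleWithPaths.Adj (fiveCycleOrder i) (fiveCycleOrder (i + 1)) := by
      decide +kernel
    exact fun i hi => this i (by omega)
  adj_last := by decide +kernel

theorem fiveCycleWithPaths_isTwoConnected : IsTwoConnected fiveCycleWithPaths :=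
  isHamiltonianOrder_fiveCycleWithPaths.isTwoConnected (by simp)

theorem fiveCycleWithPaths_isOuterplanar : IsOuterplanar fiveCycleWithPaths := by
  let k : Fin 5 × Fin 4 → ℕ := fun v => 4 * v.1 + v.2
  have hk : ∀ u v, k u = k v → u = v := by decide +kernel
  have hcross : ∀ u v, fiveCycleWithPaths.Adj u v → ∀ u' v', fiveCycleWithPaths.Adj u' v' →
      ¬ (k u < k u' ∧ k u' < k v ∧ k v < k v') := by decide +kernel
  exact isOuterplanar_of_not_crossing (fun v => (k v : ℝ))
    (fun u v h => hk u v (Nat.cast_injective h)) fun u v huv u' v' huv' h =>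
      hcross u v huv u' v' huv' (by exact_mod_cast h)

/-! ### The 5-cycle with paths has no proper 2-orientation. -/

open scoped Classical in
/-- The number of arcs from `u` to `v`. -/
noncomputable def arcCount {V : Type*} (D : Digraph V) (u v : V) : ℕ := if D.Adj u v then 1 else 0

theorem arcCount_add_arcCount {V : Type*} {G : SimpleGraph V} {D : Digraph V}
    (h : IsOrientation G D) {u v : V} (huv : G.Adj u v) : arcCount D u v + arcCount D v u = 1 := by
  rcases h.2 u v huv with ⟨h1, h2⟩ | ⟨h1, h2⟩ <;> simp [arcCount, h1, h2]

theorem inDegree_eq_sum {V : Type*} {G : SimpleGraph V} {D : Digraph V} (h : IsOrientation G D)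
    {v : V} (N : Finset V) (hN : ∀ u, G.Adj u v → u ∈ N) :
    inDegree D v = ∑ u ∈ N, arcCount D u v := by
  classical
  have : {u | D.Adj u v} = (N.filter fun u => D.Adj u v : Finset V) := by
    ext u
    simp only [Finset.coe_filter, Set.mem_ofPred_eq]
    exact ⟨fun hu => ⟨hN u (h.1 _ _ hu), hu⟩, fun hu => hu.2⟩
  rw [inDegree, this, Set.ncard_coe_finset, Finset.card_filter]
  exact Finset.sum_congr rfl fun u _ => by simp only [arcCount]

theorem not_isProperKOrientation_two (D : Digraph (Fin 5 × Fin 4)) :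
    ¬ IsProperKOrientation fiveCycleWithPaths 2 D := by
  rintro ⟨⟨ho, hp⟩, hle⟩
  have e0 : ∀ i : Fin 5, fiveCycleWithPaths.Adj (i, 0) (i + 1, 0) := by decide +kernel
  have e1 : ∀ i : Fin 5, fiveCycleWithPaths.Adj (i, 0) (i, 1) := by decide +kernel
  have e2 : ∀ i : Fin 5, fiveCycleWithPaths.Adj (i, 1) (i, 2) := by decide +kernel
  have e3 : ∀ i : Fin 5, fiveCycleWithPaths.Adj (i, 2) (i, 3) := by decide +kernel
  have e4 : ∀ i : Fin 5, fiveCycleWithPaths.Adj (i, 3) (i + 1, 0) := by decide +kernel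
  have d1 : ∀ i : Fin 5, inDegree D (i, 1) = arcCount D (i, 0) (i, 1) + arcCount D (i, 2) (i, 1) :=
    fun i => by
      rw [inDegree_eq_sum ho {(i, 0), (i, 2)} (by revert i; decide +kernel), Finset.sum_pair (by simp)]
  have d2 : ∀ i : Fin 5, inDegree D (i, 2) = arcCount D (i, 1) (i, 2) + arcCount D (i, 3) (i, 2) :=
    fun i => by
      rw [inDegree_eq_sum ho {(i, 1), (i, 3)} (by revert i; decide +kernel), Finset.sum_pair (by simp)]
  have d3 : ∀ i : Fin 5, inDegree D (i, 3) =
      arcCount D (i, 2) (i, 3) + arcCount D (i + 1, 0) (i, 3) := fun i => by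
    rw [inDegree_eq_sum ho {(i, 2), (i + 1, 0)} (by revert i; decide +kernel),
      Finset.sum_pair (by simp)]
  have d0 : ∀ i : Fin 5, inDegree D (i + 1, 0) =
      (arcCount D (i + 1 + 1, 0) (i + 1, 0) + arcCount D (i + 1, 1) (i + 1, 0)) +
      (arcCount D (i, 0) (i + 1, 0) + arcCount D (i, 3) (i + 1, 0)) := fun i => by
    rw [inDegree_eq_sum ho {(i + 1 + 1, 0), (i + 1, 1), (i, 0), (i, 3)}
        (by revert i; decide +kernel),
      Finset.sum_insert (by revert i; decide +kernel),
      Finset.sum_insert (by revert i; decide +kernel), Finset.sum_pair (by simp)]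
    exact (add_assoc _ _ _).symm
  -- the in-arcs that the ends of the `i`-th cycle edge receive from that edge and its path
  let L : Fin 5 → ℕ := fun i => arcCount D (i + 1, 0) (i, 0) + arcCount D (i, 1) (i, 0)
  let R : Fin 5 → ℕ := fun i => arcCount D (i, 0) (i + 1, 0) + arcCount D (i, 3) (i + 1, 0)
  have hf : ∀ i, inDegree D (i, 0) ≤ 2 := fun i => hle _
  let f : Fin 5 → Fin 3 := fun i => ⟨inDegree D (i, 0), by have := hf i; omega⟩
  -- The five edges of the cycle edge and its path give `L i + R i ≥ 1`, from the cycle edge. If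
  -- equality holds, all four path edges point to inner vertices, whose in-degrees are then `2, 0,
  -- 2` or `1, 2, 1`; the outer two agree, so the ends cannot have in-degrees 1 and 2.
  have hLR : ∀ i, (if (f i : ℕ) + f (i + 1) = 3 then 2 else 1) ≤ L i + R i := by
    intro i
    have a0 := arcCount_add_arcCount ho (e0 i)
    have a1 := arcCount_add_arcCount ho (e1 i)
    have a2 := arcCount_add_arcCount ho (e2 i)
    have a3 := arcCount_add_arcCount ho (e3 i)
    have a4 := arcCount_add_arcCount ho (e4 i)
    have p1 := hp _ _ (e1 i)
    have p2 := hp _ _ (e2 i)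
    have p3 := hp _ _ (e3 i)
    have p4 := hp _ _ (e4 i)
    have l1 := hf i
    have l2 := hf (i + 1)
    rw [d1] at p1 p2
    rw [d2] at p2 p3
    rw [d3] at p3 p4
    change (if inDegree D (i, 0) + inDegree D (i + 1, 0) = 3 then 2 else 1) ≤
      (arcCount D (i + 1, 0) (i, 0) + arcCount D (i, 1) (i, 0)) +
      (arcCount D (i, 0) (i + 1, 0) + arcCount D (i, 3) (i + 1, 0))
    split_ifs <;> omega
  have hsum : ∑ i, (f i : ℕ) = ∑ i, (L i + R i) := by
    have h1 : ∀ i, (f (i + 1) : ℕ) = L (i + 1) + R i := d0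
    rw [Finset.sum_add_distrib, ← Equiv.sum_comp (Equiv.addRight (1 : Fin 5)) L,
      ← Equiv.sum_comp (Equiv.addRight (1 : Fin 5)) (fun i => (f i : ℕ)), ← Finset.sum_add_distrib]
    exact Finset.sum_congr rfl fun i _ => h1 i
  have hproper : ∀ i, f i ≠ f (i + 1) := fun i h => hp _ _ (e0 i) (congrArg Fin.val h)
  -- Twice the left side is 10 plus the number of edges labelled `12` minus the number labelled
  -- `01`, and twice the right side is 10 plus twice the number labelled `12`. The inequality is
  -- strict because an odd cycle must use the label 1.
  have hcount : ∀ f : Fin 5 → Fin 3, (∀ i, f i ≠ f (i + 1)) →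
      ∑ i, (f i : ℕ) < ∑ i, if (f i : ℕ) + f (i + 1) = 3 then 2 else 1 := by decide +kernel
  have h1 := hcount f hproper
  have h2 := Finset.sum_le_sum fun i (_ : i ∈ Finset.univ) => hLR i
  omega

theorem properOrientationNumber_fiveCycleWithPaths :
    properOrientationNumber fiveCycleWithPaths = 3 := by
  refine le_antisymm (properOrientationNumber_le_three fiveCycleWithPaths_cliqueFree
    fiveCycleWithPaths_isTwoConnected fiveCycleWithPaths_isOuterplanar)
    (le_iInf₂ fun k ⟨D, hD⟩ => ?_)
  have : 3 ≤ k := by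
    by_contra! h
    exact not_isProperKOrientation_two D ⟨hD.1, fun v => (hD.2 v).trans (by omega)⟩
  exact_mod_cast this

end FiveCycle

theorem theorem1 :
    (∀ (V : Type*) [Finite V] (G : SimpleGraph V),
      G.CliqueFree 3 → IsTwoConnected G → IsOuterplanar G → properOrientationNumber G ≤ 3) ∧
    (fiveCycleWithPaths.CliqueFree 3 ∧ IsTwoConnected fiveCycleWithPaths ∧
      IsOuterplanar fiveCycleWithPaths ∧ properOrientationNumber fiveCycleWithPaths = 3) :=
  ⟨fun _ _ _ htf h2 hop => properOrientationNumber_le_three htf h2 hop,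
    fiveCycleWithPaths_cliqueFree, fiveCycleWithPaths_isTwoConnected,
    fiveCycleWithPaths_isOuterplanar, properOrientationNumber_fiveCycleWithPaths⟩
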